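/- Fix a value $\theta$ of the control parameters. Let the manifold of macroscopic observables $\mathcal{M}_\theta$, of dimension $n\ge 1$, be given in coordinates $I=(I^1,\dots,I^n)$ as a connected open subset of $\mathbb{R}^n$, with a $C^2$ Riemannian metric $g_{ij}(I|\theta)$, its Levi-Civita connection $\Gamma^k_{ij}$, and the invariant volume element $d\mu=\sqrt{|\det (g_{ij}/2\pi)|}\,dI$. Let $\mathcal{S}_g(I|\theta)$ be a $C^2$ function on $\mathcal{M}_\theta$ (the scalar entropy) such that: (i) $dp=e^{\mathcal{S}_g}d\mu=\rho\,dI$ is a probability distribution on $\mathcal{M}_\theta$; (ii) for every geodesic $\gamma$ with unitary affine parametrization ($g_{ij}\dot\gamma^i\dot\gamma^j=1$, $\ddot\gamma^k+\Gamma^k_{ij}\dot\gamma^i\dot\gamma^j=0$) the length of $\gamma$ between any parameters $t_1\le t_2$ equals $\Phi(t_1)-\Phi(t_2)$, where $\Phi(t)=\frac{d}{dt}\mathcal{S}_g[\gamma(t)|\theta]$ is the entropy production; (iii) the probability density vanishes on the boundary of $\mathcal{M}_\theta$ in an admissible coordinate representation. That is, there is a $C^2$ injective change of coordinates $\Theta$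 on $\mathcal{M}_\theta$ with nonvanishing Jacobian $|\partial\Theta/\partial I|$ such that the metric determinant in these coordinates, $\det g\,/\,|\partial\Theta/\partial I|^2$, is bounded below by a positive constant, and such that the density $\rho\,/\,|\partial\Theta/\partial I|$ of $dp$ with respect to $d\Theta$ tends to $0$ whenever the point leaves every compact subset of $\mathcal{M}_\theta$. Put $\psi_i=-\partial\mathcal{S}_g/\partial I^i$, $\psi^2=g^{ij}\psi_i\psi_j$, $\psi=\sqrt{\psi^2}$. Let $\mathcal{P}_g(\theta)=-\log\int_{\mathcal{M}_\theta}e^{-\psi^2/2}d\mu$ be the gaussian Planck potential, and let $D(P,Q|\theta)$ be the Riemannian distance (the infimum of the lengths of $C^1$ curves in $\mathcal{M}_\theta$ from $P$ to $Q$). Then there is a point $\bar I\in\mathcal{M}_\theta$ that is the unique global maximum point of $\mathcal{S}_g$ and its only stationary point, and with $r(I|\theta)=D(I,\bar I|\theta)$ one has for every $I\in\mathcal{M}_\theta$ $$\psi(I|\theta)=r(I|\theta),\qquad \mathcal{S}_g(I|\theta)=\mathcal{P}_g(\theta)-\tfrac12\psi^2(I|\theta)=\mathcal{P}_g(\theta)-\tfrac12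 r^2(I|\theta).$$ Moreover every level set of the scalar entropy is a geodesic sphere centred at $\bar I$: for every $I_0\in\mathcal{M}_\theta$, with $r_0=r(I_0|\theta)$, the set $\{I\in\mathcal{M}_\theta:\mathcal{S}_g(I|\theta)=\mathcal{S}_g(I_0|\theta)\}$ equals the boundary (in $\mathbb{R}^n$) of the $n$-dimensional ball $\{I\in\mathcal{M}_\theta: D(I,\bar I|\theta)\le r_0\}$, equals $\{I\in\mathcal{M}_\theta: D(I,\bar I|\theta)=r_0\}$, and equals the set of end points of the geodesics with unitary affine parametrization that start at $\bar I$ and have length $r_0$. -/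

import Mathlib

/-!  Riemannian thermo-statistics geometry at a fixed value of the control parameters.
The manifold of macroscopic observables is described in a coordinate representation
`I = (I¹, …, Iⁿ)`, that is, as a connected open subset of `ℝⁿ`. -/

open Set MeasureTheory

/-- The partial derivative `∂f / ∂Iⁱ`. -/
noncomputable def partialDeriv {n : ℕ} (i : Fin n) (f : (Fin n → ℝ) → ℝ) (x : Fin n → ℝ) : ℝ :=
  fderiv ℝ f x (Pi.single i 1)

/-- A connected Riemannian manifold in a global coordinate representation: a connected open set
of `ℝⁿ` with a twice continuously differentiable, symmetric, positive definite metric tensor. -/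
structure RiemannianDomain (n : ℕ) where
  carrier : Set (Fin n → ℝ)
  isOpen_carrier : IsOpen carrier
  isConnected_carrier : IsConnected carrier
  /-- The metric tensor `g_{ij}(I)`. -/
  metric : (Fin n → ℝ) → Matrix (Fin n) (Fin n) ℝ
  contDiffOn_metric : ∀ i j, ContDiffOn ℝ 2 (fun x => metric x i j) carrier
  posDef_metric : ∀ x ∈ carrier, (metric x).PosDef

namespace RiemannianDomain

variable {n : ℕ} (M : RiemannianDomain n)

/-- `g_{ij}(x) vⁱ vʲ`. -/
def normSq (x v : Fin n → ℝ) : ℝ :=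
  ∑ i, ∑ j, M.metric x i j * v i * v j

/-- The coefficients `Γᵏ_{ij}` of the Levi-Civita connection. -/
noncomputable def christoffel (k i j : Fin n) (x : Fin n → ℝ) : ℝ :=
  ∑ m, (M.metric x)⁻¹ k m * ((1 / 2) *
    (partialDeriv j (fun y => M.metric y i m) x + partialDeriv i (fun y => M.metric y j m) x
      - partialDeriv m (fun y => M.metric y i j) x))

/-- The length of the curve `γ` between the parameters `a` and `b`. -/
noncomputable def curveLength (γ : ℝ → Fin n → ℝ) (a b : ℝ) : ℝ :=
  ∫ t in a..b, Real.sqrt (M.normSq (γ t) (deriv γ t))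

/-- On the set `J` of parameters, `γ` is a geodesic of the manifold with unitary affine
parametrization: `g_{ij} γ̇ⁱ γ̇ʲ = 1` and `γ̈ᵏ + Γᵏ_{ij}(γ) γ̇ⁱ γ̇ʲ = 0`. -/
def IsUnitGeodesicOn (γ : ℝ → Fin n → ℝ) (J : Set ℝ) : Prop :=
  ∀ t ∈ J, γ t ∈ M.carrier ∧ DifferentiableAt ℝ γ t ∧
    M.normSq (γ t) (deriv γ t) = 1 ∧
    HasDerivAt (deriv γ)
      (fun k => -∑ i, ∑ j, M.christoffel k i j (γ t) * deriv γ t i * deriv γ t j) t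

/-- The Riemannian distance: the infimum of the lengths of the continuously differentiable curves
in the manifold that join `P` to `Q`. -/
noncomputable def distance (P Q : Fin n → ℝ) : ℝ :=
  sInf {L : ℝ | ∃ (γ : ℝ → Fin n → ℝ) (a b : ℝ), a ≤ b ∧ ContDiffOn ℝ 1 γ (Icc a b) ∧
    (∀ t ∈ Icc a b, γ t ∈ M.carrier) ∧ γ a = P ∧ γ b = Q ∧ L = M.curveLength γ a b}

/-- The geodesic sphere: all points reached from `C` by a geodesic of length `r`. -/
def geodesicSphere (C : Fin n → ℝ) (r : ℝ) : Set (Fin n → ℝ) :=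
  {x | ∃ γ : ℝ → Fin n → ℝ, M.IsUnitGeodesicOn γ (Icc 0 r) ∧ γ 0 = C ∧ γ r = x}

/-- The points of the manifold at distance exactly `r` from `C`. -/
def metricSphere (C : Fin n → ℝ) (r : ℝ) : Set (Fin n → ℝ) :=
  {x | x ∈ M.carrier ∧ M.distance x C = r}

/-- The solid `n`-dimensional sphere (closed ball) of radius `r` centred at `C`. -/
def solidSphere (C : Fin n → ℝ) (r : ℝ) : Set (Fin n → ℝ) :=
  {x | x ∈ M.carrier ∧ M.distance x C ≤ r}

/-- The density `√|det (g_{ij} / 2π)|` of the invariant volume element. -/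
noncomputable def volumeDensity (x : Fin n → ℝ) : ℝ :=
  Real.sqrt |((2 * Real.pi)⁻¹ • M.metric x).det|

/-- `Θ` is a change of coordinates of the manifold. -/
def IsReparametrization (Θ : (Fin n → ℝ) → (Fin n → ℝ)) : Prop :=
  ContDiffOn ℝ 2 Θ M.carrier ∧ InjOn Θ M.carrier ∧ ∀ x ∈ M.carrier, (fderiv ℝ Θ x).det ≠ 0

/-- An admissible coordinate representation: the determinant of the metric tensor in the
coordinates `Θ`, which is `det g / |∂Θ/∂I|²`, does not degenerate, not even when the boundary is
approached. -/
def IsAdmissible (Θ : (Fin n → ℝ) → (Fin n → ℝ)) : Prop :=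
  M.IsReparametrization Θ ∧
    ∃ c : ℝ, 0 < c ∧ ∀ x ∈ M.carrier, c ≤ (M.metric x).det / (fderiv ℝ Θ x).det ^ 2

/-- `f` vanishes on the boundary of the manifold: it tends to `0` when the point leaves every
compact subset of the manifold (towards the frontier or towards infinity). -/
def VanishesOnBoundary (f : (Fin n → ℝ) → ℝ) : Prop :=
  ∀ ε : ℝ, 0 < ε → ∃ K : Set (Fin n → ℝ), IsCompact K ∧ K ⊆ M.carrier ∧
    ∀ x ∈ M.carrier \ K, |f x| < ε

end RiemannianDomain

/-- A Riemannian thermo-statistics geometry: the manifold of macroscopic observables with its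
scalar entropy, at a fixed value of the control parameters. -/
structure ThermoStatGeometry (n : ℕ) extends RiemannianDomain n where
  /-- The scalar entropy. -/
  entropy : (Fin n → ℝ) → ℝ
  contDiffOn_entropy : ContDiffOn ℝ 2 entropy carrier
  /-- `exp S` is a probability density with respect to the invariant volume element. -/
  integral_density : ∫ x in carrier, Real.exp (entropy x) * toRiemannianDomain.volumeDensity x = 1
  /-- The length of any interval of any geodesic with unitary affine parametrization is the
  decrease of the entropy production `Φ = d S(γ(t)) / dt` over it. -/
  length_eq_entropy_production : ∀ (γ : ℝ → Fin n → ℝ) (t₁ t₂ : ℝ), t₁ ≤ t₂ →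
    toRiemannianDomain.IsUnitGeodesicOn γ (Icc t₁ t₂) →
    toRiemannianDomain.curveLength γ t₁ t₂
      = deriv (fun t => entropy (γ t)) t₁ - deriv (fun t => entropy (γ t)) t₂
  /-- In an admissible coordinate representation `Θ`, the probability density with respect to
  `dΘ`, which is `ρ / |∂Θ/∂I|`, vanishes on the boundary. -/
  density_vanishesOnBoundary : ∃ Θ : (Fin n → ℝ) → (Fin n → ℝ),
    toRiemannianDomain.IsAdmissible Θ ∧ toRiemannianDomain.VanishesOnBoundary (fun x =>
      Real.exp (entropy x) * toRiemannianDomain.volumeDensity x / |(fderiv ℝ Θ x).det|)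

namespace ThermoStatGeometry

variable {n : ℕ} (G : ThermoStatGeometry n)

/-- The gradiental generalized forces `ψ_i = -∂S/∂Iⁱ`. -/
noncomputable def force (i : Fin n) (x : Fin n → ℝ) : ℝ :=
  -partialDeriv i G.entropy x

/-- The square norm `ψ² = g^{ij} ψ_i ψ_j`. -/
noncomputable def forceSq (x : Fin n → ℝ) : ℝ :=
  ∑ i, ∑ j, (G.metric x)⁻¹ i j * G.force i x * G.force j x

/-- The norm `ψ` of the gradiental generalized forces. -/
noncomputable def forceNorm (x : Fin n → ℝ) : ℝ :=
  Real.sqrt (G.forceSq x)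

/-- The gaussian partition function `Z_g = ∫ exp (-ψ²/2) dμ`. -/
noncomputable def partitionFunction : ℝ :=
  ∫ x in G.carrier, Real.exp (-(1 / 2) * G.forceSq x) * G.volumeDensity x

/-- The gaussian Planck potential `P_g = -log Z_g`. -/
noncomputable def planckPotential : ℝ :=
  -Real.log G.partitionFunction

end ThermoStatGeometry

/-!
The condition on the entropy production says that `S ∘ γ` has second derivative `-1` along every unit
geodesic. As there is a geodesic in each direction, the covariant Hessian of `S` is `-g`
(`hessian_entropy_self`). Contracting with the gradient gives `d(ψ²) = -2 dS`
(`hasFDerivAt_forceSq`), so on the connected manifold `S` is a constant minus `ψ²/2`, and the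
normalization of the density identifies the constant with the Planck potential (`entropy_eq`).

In admissible coordinates the volume density is bounded below, so a density vanishing on the boundary
forces `S → -∞` there: the sets `{ψ² ≤ c}` are compact (`isCompact_forceSq_le`).

The geodesic from `x` with initial velocity `grad S` satisfies `ψ²(γ t) = ψ²(x) (1 - t)²`
(`forceSq_along_geodesic`), hence stays in a compact part of the phase space, exists up to `t = 1`
(`exists_gradient_geodesic`) and ends there in a stationary point of `S`. The end point depends
continuously on `x`, by Grönwall's inequality, while stationary points are isolated because the
Hessian is nondegenerate. Connectedness makes the end point a constant `Ibar`, and as a gradient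
geodesic issuing from a stationary point does not move, `Ibar` is the only stationary point
(`exists_forall_gradient_geodesic_endpoint_eq`, `endpoint_eq_of_forceSq_eq_zero`).

The gradient geodesic from `x` to `Ibar` has length `ψ(x)`, and no curve from `x` to `Ibar` is
shorter, since `dS(w)² ≤ ψ² g(w, w)` bounds the variation of `ψ` along a curve by its length
(`forceNorm_eq_distance`). So level sets of `S` are metric spheres; run backwards with unit speed, the
gradient geodesics are the geodesics from `Ibar` that sweep these spheres out (`mem_geodesicSphere`).
-/

open Filter Topology

-- lets instance search find `IsBoundedSMul` for the space of bilinear forms on `Fin n → ℝ`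
set_option maxSynthPendingDepth 3

/-! ### The metric as a field of bilinear forms -/

lemma fderiv_apply_eq_sum_partialDeriv {n : ℕ} (f : (Fin n → ℝ) → ℝ) (x w : Fin n → ℝ) :
    fderiv ℝ f x w = ∑ k, w k * partialDeriv k f x := by
  conv_lhs => rw [pi_eq_sum_univ' w, map_sum]
  refine Finset.sum_congr rfl fun k _ => ?_
  rw [map_smul, smul_eq_mul, partialDeriv]

namespace RiemannianDomain

variable {n : ℕ} (M : RiemannianDomain n)

lemma mem_nhds {x : Fin n → ℝ} (hx : x ∈ M.carrier) : M.carrier ∈ 𝓝 x :=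
  M.isOpen_carrier.mem_nhds hx

/-- The metric tensor as a field of continuous bilinear forms. -/
noncomputable def form (x : Fin n → ℝ) : (Fin n → ℝ) →L[ℝ] (Fin n → ℝ) →L[ℝ] ℝ :=
  ∑ i, ∑ j, M.metric x i j •
    (ContinuousLinearMap.proj i : (Fin n → ℝ) →L[ℝ] ℝ).smulRight
      (ContinuousLinearMap.proj j : (Fin n → ℝ) →L[ℝ] ℝ)

lemma form_apply (x v w : Fin n → ℝ) :
    M.form x v w = ∑ i, ∑ j, M.metric x i j * v i * w j := by
  simp [form, mul_assoc]

lemma normSq_eq_form (x v : Fin n → ℝ) : M.normSq x v = M.form x v v := by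
  rw [form_apply, normSq]

lemma contDiffOn_form : ContDiffOn ℝ 2 M.form M.carrier := by
  unfold form
  exact ContDiffOn.sum fun i _ => ContDiffOn.sum fun j _ =>
    (M.contDiffOn_metric i j).smul contDiffOn_const

lemma metric_differentiableAt {x : Fin n → ℝ} (hx : x ∈ M.carrier) (i j : Fin n) :
    DifferentiableAt ℝ (fun y => M.metric y i j) x :=
  ((M.contDiffOn_metric i j).contDiffAt (M.mem_nhds hx)).differentiableAt (by simp)

lemma form_differentiableAt {x : Fin n → ℝ} (hx : x ∈ M.carrier) :
    DifferentiableAt ℝ M.form x :=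
  (M.contDiffOn_form.contDiffAt (M.mem_nhds hx)).differentiableAt (by simp)

lemma fderiv_form_apply {x : Fin n → ℝ} (hx : x ∈ M.carrier) (u v w : Fin n → ℝ) :
    fderiv ℝ M.form x u v w
      = ∑ i, ∑ j, fderiv ℝ (fun y => M.metric y i j) x u * v i * w j := by
  have h : HasFDerivAt M.form (∑ i, ∑ j, (fderiv ℝ (fun y => M.metric y i j) x).smulRight
      ((ContinuousLinearMap.proj i : (Fin n → ℝ) →L[ℝ] ℝ).smulRight
        (ContinuousLinearMap.proj j : (Fin n → ℝ) →L[ℝ] ℝ))) x := by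
    unfold form
    exact HasFDerivAt.fun_sum fun i _ => HasFDerivAt.fun_sum fun j _ =>
      HasFDerivAt.smul_const (M.metric_differentiableAt hx i j).hasFDerivAt _
  rw [h.fderiv]
  simp [mul_assoc]

lemma metric_symm {x : Fin n → ℝ} (hx : x ∈ M.carrier) (i j : Fin n) :
    M.metric x i j = M.metric x j i := by
  simpa using ((M.posDef_metric x hx).1.apply j i)

lemma form_symm {x : Fin n → ℝ} (hx : x ∈ M.carrier) (v w : Fin n → ℝ) :
    M.form x v w = M.form x w v := by
  rw [form_apply, form_apply, Finset.sum_comm]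
  refine Finset.sum_congr rfl fun i _ => Finset.sum_congr rfl fun j _ => ?_
  rw [M.metric_symm hx]
  ring

lemma fderiv_form_symm {x : Fin n → ℝ} (hx : x ∈ M.carrier) (u v w : Fin n → ℝ) :
    fderiv ℝ M.form x u v w = fderiv ℝ M.form x u w v := by
  rw [M.fderiv_form_apply hx, M.fderiv_form_apply hx, Finset.sum_comm]
  refine Finset.sum_congr rfl fun i _ => Finset.sum_congr rfl fun j _ => ?_
  have : (fun y => M.metric y j i) =ᶠ[𝓝 x] fun y => M.metric y i j :=
    eventually_of_mem (M.mem_nhds hx) fun y hy => M.metric_symm hy j i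
  rw [this.fderiv_eq]
  ring

lemma form_pos {x : Fin n → ℝ} (hx : x ∈ M.carrier) {v : Fin n → ℝ} (hv : v ≠ 0) :
    0 < M.form x v v := by
  have := (M.posDef_metric x hx).dotProduct_mulVec_pos hv
  rw [form_apply]
  simpa [dotProduct, Matrix.mulVec, Finset.mul_sum, mul_comm, mul_assoc, mul_left_comm] using this

lemma form_self_nonneg {x : Fin n → ℝ} (hx : x ∈ M.carrier) (v : Fin n → ℝ) :
    0 ≤ M.form x v v := by
  rcases eq_or_ne v 0 with rfl | hv
  · simp
  · exact (M.form_pos hx hv).le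

lemma form_self_eq_zero {x : Fin n → ℝ} (hx : x ∈ M.carrier) {v : Fin n → ℝ} :
    M.form x v v = 0 ↔ v = 0 :=
  ⟨fun h => by_contra fun hv => (M.form_pos hx hv).ne' h, fun h => by simp [h]⟩

/-- The Cauchy–Schwarz inequality for the metric. -/
lemma form_sq_le {x : Fin n → ℝ} (hx : x ∈ M.carrier) (v w : Fin n → ℝ) :
    M.form x v w ^ 2 ≤ M.form x v v * M.form x w w := by
  rcases eq_or_ne v 0 with rfl | hv
  · simp
  have h0 := M.form_pos hx hv
  have h := M.form_self_nonneg hx (M.form x v v • w - M.form x v w • v)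
  have hs := M.form_symm hx w v
  simp only [map_sub, map_smul, _root_.sub_apply, _root_.smul_apply,
    smul_eq_mul, hs] at h
  have : 0 ≤ M.form x v v * (M.form x v v * M.form x w w - M.form x v w ^ 2) := by
    linarith
  have := nonneg_of_mul_nonneg_right this h0
  linarith

/-! ### The geodesic equation -/

/-- The quadratic term `Γᵏ_{ij} vⁱ vʲ` of the geodesic equation. -/
noncomputable def spray (x v : Fin n → ℝ) : Fin n → ℝ :=
  fun k => ∑ i, ∑ j, M.christoffel k i j x * v i * v j

/-- The Koszul formula for the Levi-Civita connection, contracted with the vector `v` twice. -/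
lemma form_spray {x : Fin n → ℝ} (hx : x ∈ M.carrier) (v w : Fin n → ℝ) :
    M.form x (M.spray x v) w
      = fderiv ℝ M.form x v v w - 1 / 2 * fderiv ℝ M.form x w v v := by
  set p : Fin n → Fin n → Fin n → ℝ := fun k i j => partialDeriv k (fun y => M.metric y i j) x
    with hp
  have hdet : IsUnit (M.metric x).det := (M.posDef_metric x hx).det_pos.ne'.isUnit
  have key : ∀ l i j, ∑ k, M.metric x l k * M.christoffel k i j x
      = 1 / 2 * (p j i l + p i j l - p l i j) := by
    intro l i j
    have h1 : (fun k => M.christoffel k i j x)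
        = (M.metric x)⁻¹.mulVec (fun m => 1 / 2 * (p j i m + p i j m - p m i j)) := by
      ext k
      simp [christoffel, Matrix.mulVec, dotProduct, hp]
    have h2 : (M.metric x).mulVec (fun k => M.christoffel k i j x)
        = fun m => 1 / 2 * (p j i m + p i j m - p m i j) := by
      rw [h1, Matrix.mulVec_mulVec, Matrix.mul_nonsing_inv _ hdet, Matrix.one_mulVec]
    exact congrFun h2 l
  have lhs : M.form x (M.spray x v) w
      = ∑ l, ∑ i, ∑ j, (1 / 2 * (p j i l + p i j l - p l i j)) * v i * v j * w l := by
    rw [M.form_symm hx, form_apply]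
    refine Finset.sum_congr rfl fun l _ => ?_
    simp only [← key, spray, Finset.mul_sum, Finset.sum_mul]
    rw [Finset.sum_comm]
    refine Finset.sum_congr rfl fun i _ => ?_
    rw [Finset.sum_comm]
    refine Finset.sum_congr rfl fun j _ => Finset.sum_congr rfl fun k _ => ?_
    ring
  have d1 : fderiv ℝ M.form x v v w = ∑ l, ∑ i, ∑ j, p j i l * v i * v j * w l := by
    rw [M.fderiv_form_apply hx, Finset.sum_comm]
    refine Finset.sum_congr rfl fun l _ => Finset.sum_congr rfl fun i _ => ?_
    rw [fderiv_apply_eq_sum_partialDeriv]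
    simp only [Finset.sum_mul]
    refine Finset.sum_congr rfl fun j _ => ?_
    simp only [hp]; ring
  have d2 : fderiv ℝ M.form x v v w = ∑ l, ∑ i, ∑ j, p i j l * v i * v j * w l := by
    rw [d1]
    refine Finset.sum_congr rfl fun l _ => ?_
    rw [Finset.sum_comm]
    refine Finset.sum_congr rfl fun i _ => Finset.sum_congr rfl fun j _ => ?_
    ring
  have d3 : fderiv ℝ M.form x w v v = ∑ l, ∑ i, ∑ j, p l i j * v i * v j * w l := by
    rw [M.fderiv_form_apply hx]
    simp only [fderiv_apply_eq_sum_partialDeriv, Finset.sum_mul]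
    calc _ = ∑ i, ∑ l, ∑ j, w l * p l i j * v i * v j :=
          Finset.sum_congr rfl fun i _ => Finset.sum_comm
      _ = _ := by
          rw [Finset.sum_comm]
          refine Finset.sum_congr rfl fun l _ => Finset.sum_congr rfl fun i _ =>
            Finset.sum_congr rfl fun j _ => ?_
          ring
  have : fderiv ℝ M.form x v v w
      = 1 / 2 * fderiv ℝ M.form x v v w + 1 / 2 * fderiv ℝ M.form x v v w := by ring
  rw [this, lhs]
  nth_rewrite 1 [d1]
  rw [d2, d3]
  simp only [Finset.mul_sum, ← Finset.sum_add_distrib, ← Finset.sum_sub_distrib]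
  refine Finset.sum_congr rfl fun l _ => Finset.sum_congr rfl fun i _ =>
    Finset.sum_congr rfl fun j _ => ?_
  ring

lemma contDiffOn_det {m : WithTop ℕ∞} {s : Set (Fin n → ℝ)}
    {A : (Fin n → ℝ) → Matrix (Fin n) (Fin n) ℝ} (hA : ∀ i j, ContDiffOn ℝ m (fun x => A x i j) s) :
    ContDiffOn ℝ m (fun x => (A x).det) s := by
  simp only [Matrix.det_apply]
  exact ContDiffOn.sum fun σ _ => (contDiffOn_prod fun i _ => hA _ _).const_smul _

lemma contDiffOn_inv_metric (i j : Fin n) :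
    ContDiffOn ℝ 2 (fun x => (M.metric x)⁻¹ i j) M.carrier := by
  have h : ∀ x, (M.metric x)⁻¹ i j = (M.metric x).det⁻¹ * (M.metric x).adjugate i j := by
    intro x
    simp [Matrix.inv_def, Ring.inverse_eq_inv']
  simp only [h, Matrix.adjugate_apply]
  refine (ContDiffOn.inv (contDiffOn_det M.contDiffOn_metric)
    fun x hx => (M.posDef_metric x hx).det_pos.ne').mul (contDiffOn_det fun k l => ?_)
  by_cases hk : k = j
  · simp only [hk, Matrix.updateRow_self]
    exact contDiffOn_const
  · simp only [Matrix.updateRow_ne hk]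
    exact M.contDiffOn_metric k l

end RiemannianDomain

lemma contDiffOn_partialDeriv {n : ℕ} {f : (Fin n → ℝ) → ℝ} {s : Set (Fin n → ℝ)} (hs : IsOpen s)
    (hf : ContDiffOn ℝ 2 f s) (i : Fin n) : ContDiffOn ℝ 1 (partialDeriv i f) s :=
  (hf.fderiv_of_isOpen hs (by norm_num)).clm_apply contDiffOn_const

namespace RiemannianDomain

variable {n : ℕ} (M : RiemannianDomain n)

lemma contDiffOn_christoffel (k i j : Fin n) :
    ContDiffOn ℝ 1 (M.christoffel k i j) M.carrier := by
  unfold christoffel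
  refine ContDiffOn.sum fun m _ => ((M.contDiffOn_inv_metric k m).of_le (by norm_num)).mul
    (contDiffOn_const.mul ?_)
  have h := fun a b c => contDiffOn_partialDeriv M.isOpen_carrier (M.contDiffOn_metric a b) c
  exact ((h i m j).add (h j m i)).sub (h i j m)

/-- The geodesic equation as a first order system for position and velocity. -/
noncomputable def geodesicField (z : (Fin n → ℝ) × (Fin n → ℝ)) : (Fin n → ℝ) × (Fin n → ℝ) :=
  (z.2, -M.spray z.1 z.2)

lemma contDiffOn_geodesicField :
    ContDiffOn ℝ 1 M.geodesicField (M.carrier ×ˢ univ) := by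
  unfold geodesicField
  refine contDiff_snd.contDiffOn.prodMk (ContDiffOn.neg ?_)
  rw [contDiffOn_pi]
  intro k
  unfold spray
  refine ContDiffOn.sum fun i _ => ContDiffOn.sum fun j _ => ?_
  have hv : ∀ l : Fin n, ContDiffOn ℝ 1
      (fun z : (Fin n → ℝ) × (Fin n → ℝ) => z.2 l) (M.carrier ×ˢ univ) :=
    fun l => ((contDiff_apply ℝ ℝ l).comp contDiff_snd).contDiffOn
  exact (((M.contDiffOn_christoffel k i j).comp contDiff_fst.contDiffOn
    (fun z hz => hz.1)).mul (hv i)).mul (hv j)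

lemma isOpen_phaseSpace : IsOpen (M.carrier ×ˢ (univ : Set (Fin n → ℝ))) :=
  M.isOpen_carrier.prod isOpen_univ

/-- The speed of a geodesic is constant: infinitesimal form. -/
lemma hasDerivAt_form_self {x v : ℝ → Fin n → ℝ} {t : ℝ} (hM : x t ∈ M.carrier)
    (hx : HasDerivAt x (v t) t) (hv : HasDerivAt v (-M.spray (x t) (v t)) t) :
    HasDerivAt (fun s => M.form (x s) (v s) (v s)) 0 t := by
  have h3 : HasDerivAt (fun s => M.form (x s)) (fderiv ℝ M.form (x t) (v t)) t :=
    (M.form_differentiableAt hM).hasFDerivAt.comp_hasDerivAt t hx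
  refine ((h3.clm_apply hv).clm_apply hv).congr_deriv ?_
  simp only [_root_.add_apply, map_neg, _root_.neg_apply]
  rw [M.form_symm hM (v t), M.form_spray hM]
  ring

/-- Around the parameter `t`, the curve `x` with velocity `v` is a geodesic of the manifold, of
arbitrary constant speed. -/
def IsGeodesicAt (x v : ℝ → Fin n → ℝ) (t : ℝ) : Prop :=
  ∀ᶠ s in 𝓝 t, x s ∈ M.carrier ∧ HasDerivAt x (v s) s ∧ HasDerivAt v (-M.spray (x s) (v s)) s

variable {M}

lemma IsGeodesicAt.mem {x v : ℝ → Fin n → ℝ} {t : ℝ} (h : M.IsGeodesicAt x v t) :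
    x t ∈ M.carrier := (h.self_of_nhds).1

lemma IsGeodesicAt.hasDerivAt {x v : ℝ → Fin n → ℝ} {t : ℝ} (h : M.IsGeodesicAt x v t) :
    HasDerivAt x (v t) t := (h.self_of_nhds).2.1

lemma IsGeodesicAt.hasDerivAt_velocity {x v : ℝ → Fin n → ℝ} {t : ℝ}
    (h : M.IsGeodesicAt x v t) : HasDerivAt v (-M.spray (x t) (v t)) t := (h.self_of_nhds).2.2

lemma IsGeodesicAt.deriv_eventuallyEq {x v : ℝ → Fin n → ℝ} {t : ℝ}
    (h : M.IsGeodesicAt x v t) : deriv x =ᶠ[𝓝 t] v :=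
  h.mono fun _ hs => hs.2.1.deriv

lemma isUnitGeodesicOn_of_isGeodesicAt {x v : ℝ → Fin n → ℝ} {J : Set ℝ}
    (h : ∀ t ∈ J, M.IsGeodesicAt x v t) (h1 : ∀ t ∈ J, M.form (x t) (v t) (v t) = 1) :
    M.IsUnitGeodesicOn x J := by
  intro t ht
  have hd := (h t ht).deriv_eventuallyEq
  refine ⟨(h t ht).mem, (h t ht).hasDerivAt.differentiableAt, ?_, ?_⟩
  · rw [hd.self_of_nhds, normSq_eq_form, h1 t ht]
  · rw [hd.self_of_nhds]
    exact (h t ht).hasDerivAt_velocity.congr_of_eventuallyEq hd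

/-- Geodesics have constant speed. -/
lemma form_velocity_eq {x v : ℝ → Fin n → ℝ} {T : ℝ}
    (h : ∀ t ∈ Icc 0 T, M.IsGeodesicAt x v t) :
    ∀ t ∈ Icc 0 T, M.form (x t) (v t) (v t) = M.form (x 0) (v 0) (v 0) := by
  have hd : ∀ t ∈ Icc 0 T, HasDerivAt (fun s => M.form (x s) (v s) (v s)) 0 t := fun t ht =>
    M.hasDerivAt_form_self (h t ht).mem (h t ht).hasDerivAt (h t ht).hasDerivAt_velocity
  exact constant_of_has_deriv_right_zero
    (fun t ht => (hd t ht).continuousAt.continuousWithinAt)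
    (fun t ht => (hd t (Ico_subset_Icc_self ht)).hasDerivWithinAt)

variable (M)

lemma exists_isGeodesicAt {x₀ : Fin n → ℝ} (hx : x₀ ∈ M.carrier) (v₀ : Fin n → ℝ) :
    ∃ (x v : ℝ → Fin n → ℝ) (ε : ℝ), 0 < ε ∧ x 0 = x₀ ∧ v 0 = v₀ ∧
      ∀ t ∈ Icc 0 ε, M.IsGeodesicAt x v t := by
  have hc : ContDiffAt ℝ 1 M.geodesicField (x₀, v₀) :=
    M.contDiffOn_geodesicField.contDiffAt (M.isOpen_phaseSpace.mem_nhds ⟨hx, mem_univ _⟩)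
  obtain ⟨y, hy0, ε, hε, hy⟩ :=
    hc.exists_forall_mem_closedBall_exists_eq_forall_mem_Ioo_hasDerivAt₀ 0
  simp only [zero_sub, zero_add] at hy
  have hyc : ContinuousAt y 0 := (hy 0 ⟨by linarith, hε⟩).continuousAt
  have hmem : ∀ᶠ t in 𝓝 (0 : ℝ), (y t).1 ∈ M.carrier ∧ t ∈ Ioo (-ε) ε := by
    refine Eventually.and ?_ (Ioo_mem_nhds (by linarith) hε)
    have : ContinuousAt (fun t => (y t).1) 0 := continuous_fst.continuousAt.comp hyc
    exact this.eventually_mem (by rw [hy0]; exact M.mem_nhds hx)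
  obtain ⟨δ, hδ, hball⟩ := Metric.eventually_nhds_iff_ball.1 hmem
  refine ⟨fun t => (y t).1, fun t => (y t).2, δ / 2, by positivity, by simp [hy0],
    by simp [hy0], fun t ht => ?_⟩
  have htb : t ∈ Metric.ball (0 : ℝ) δ := by
    rw [Metric.mem_ball, Real.dist_0_eq_abs, abs_of_nonneg ht.1]
    linarith [ht.2]
  filter_upwards [Metric.isOpen_ball.mem_nhds htb] with s hs
  obtain ⟨h1, h2⟩ := hball s hs
  exact ⟨h1, (hy s h2).fst, (hy s h2).snd⟩

lemma spray_smul (x v : Fin n → ℝ) (c : ℝ) : M.spray x (c • v) = c ^ 2 • M.spray x v := by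
  ext k
  simp only [spray, Pi.smul_apply, smul_eq_mul, Finset.mul_sum]
  refine Finset.sum_congr rfl fun i _ => Finset.sum_congr rfl fun j _ => ?_
  ring

/-- A unit geodesic has length equal to the length of its parameter interval. -/
lemma curveLength_of_isUnitGeodesicOn {γ : ℝ → Fin n → ℝ} {a b : ℝ} (hab : a ≤ b)
    (h : M.IsUnitGeodesicOn γ (Icc a b)) : M.curveLength γ a b = b - a := by
  have : EqOn (fun t => Real.sqrt (M.normSq (γ t) (deriv γ t))) (fun _ => 1) (uIcc a b) := by
    intro t ht
    rw [uIcc_of_le hab] at ht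
    simp [(h t ht).2.2.1]
  rw [curveLength, intervalIntegral.integral_congr this]
  simp

end RiemannianDomain

namespace ThermoStatGeometry

variable {n : ℕ} (G : ThermoStatGeometry n)

/-! ### The Hessian of the entropy is minus the metric -/

lemma entropy_contDiffAt {x : Fin n → ℝ} (hx : x ∈ G.carrier) : ContDiffAt ℝ 2 G.entropy x :=
  G.contDiffOn_entropy.contDiffAt (G.mem_nhds hx)

lemma entropy_differentiableAt {x : Fin n → ℝ} (hx : x ∈ G.carrier) :
    DifferentiableAt ℝ G.entropy x :=
  (G.entropy_contDiffAt hx).differentiableAt (by simp)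

lemma contDiffOn_fderiv_entropy : ContDiffOn ℝ 1 (fderiv ℝ G.entropy) G.carrier :=
  G.contDiffOn_entropy.fderiv_of_isOpen G.isOpen_carrier (by norm_num)

lemma fderiv_entropy_differentiableAt {x : Fin n → ℝ} (hx : x ∈ G.carrier) :
    DifferentiableAt ℝ (fderiv ℝ G.entropy) x :=
  (G.contDiffOn_fderiv_entropy.contDiffAt (G.mem_nhds hx)).differentiableAt (by simp)

lemma hasDerivAt_entropy_comp {γ : ℝ → Fin n → ℝ} {w : Fin n → ℝ} {t : ℝ}
    (hM : γ t ∈ G.carrier) (h : HasDerivAt γ w t) :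
    HasDerivAt (fun s => G.entropy (γ s)) (fderiv ℝ G.entropy (γ t) w) t :=
  (G.entropy_differentiableAt hM).hasFDerivAt.comp_hasDerivAt t h

/-- The entropy production of a unit geodesic decreases with unit rate. -/
lemma deriv_entropy_of_isUnitGeodesicOn {γ : ℝ → Fin n → ℝ} {r : ℝ}
    (h : G.IsUnitGeodesicOn γ (Icc 0 r)) {t : ℝ} (ht : t ∈ Icc 0 r) :
    deriv (fun s => G.entropy (γ s)) t = deriv (fun s => G.entropy (γ s)) 0 - t := by
  have h' : G.IsUnitGeodesicOn γ (Icc 0 t) := fun s hs => h s ⟨hs.1, hs.2.trans ht.2⟩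
  have h1 := G.length_eq_entropy_production γ 0 t ht.1 h'
  rw [G.curveLength_of_isUnitGeodesicOn ht.1 h'] at h1
  linarith

lemma hasDerivAt_fderiv_entropy_velocity {x v : ℝ → Fin n → ℝ} {t : ℝ}
    (h : G.IsGeodesicAt x v t) :
    HasDerivAt (fun s => fderiv ℝ G.entropy (x s) (v s))
      (fderiv ℝ (fderiv ℝ G.entropy) (x t) (v t) (v t)
        - fderiv ℝ G.entropy (x t) (G.spray (x t) (v t))) t := by
  have h1 : HasDerivAt (fun s => fderiv ℝ G.entropy (x s))
      (fderiv ℝ (fderiv ℝ G.entropy) (x t) (v t)) t :=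
    (G.fderiv_entropy_differentiableAt h.mem).hasFDerivAt.comp_hasDerivAt t h.hasDerivAt
  refine (h1.clm_apply h.hasDerivAt_velocity).congr_deriv ?_
  rw [map_neg, sub_eq_add_neg]

/-- The second covariant derivative of the entropy is minus the metric. -/
lemma hessian_entropy_self {x : Fin n → ℝ} (hx : x ∈ G.carrier) (v : Fin n → ℝ) :
    fderiv ℝ (fderiv ℝ G.entropy) x v v - fderiv ℝ G.entropy x (G.spray x v)
      = -G.form x v v := by
  -- for unit vectors, the entropy production along the geodesic in the direction `w` is
  -- differentiated at its starting point; the general case follows by homogeneity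
  have unit : ∀ w, G.form x w w = 1 →
      fderiv ℝ (fderiv ℝ G.entropy) x w w - fderiv ℝ G.entropy x (G.spray x w) = -1 := by
    intro w hw
    obtain ⟨γ, V, ε, hε, h0, hV0, hg⟩ := G.exists_isGeodesicAt hx w
    have hunit : G.IsUnitGeodesicOn γ (Icc 0 ε) :=
      RiemannianDomain.isUnitGeodesicOn_of_isGeodesicAt hg fun t ht => by
        rw [RiemannianDomain.form_velocity_eq hg t ht, h0, hV0, hw]
    have hprod : ∀ t ∈ Icc 0 ε, fderiv ℝ G.entropy (γ t) (V t)
        = fderiv ℝ G.entropy (γ 0) (V 0) - t := by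
      intro t ht
      have := G.deriv_entropy_of_isUnitGeodesicOn hunit ht
      rwa [(G.hasDerivAt_entropy_comp (hg t ht).mem (hg t ht).hasDerivAt).deriv,
        (G.hasDerivAt_entropy_comp (hg 0 ⟨le_rfl, hε.le⟩).mem
          (hg 0 ⟨le_rfl, hε.le⟩).hasDerivAt).deriv] at this
    have h0mem : (0 : ℝ) ∈ Icc 0 ε := ⟨le_rfl, hε.le⟩
    have hd1 := (G.hasDerivAt_fderiv_entropy_velocity (hg 0 h0mem)).hasDerivWithinAt
      (s := Icc 0 ε)
    have hd2 : HasDerivWithinAt (fun s => fderiv ℝ G.entropy (γ s) (V s)) (-1) (Icc 0 ε) 0 := by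
      refine HasDerivWithinAt.congr_of_mem ?_ hprod h0mem
      exact ((hasDerivAt_id (0 : ℝ)).const_sub _).hasDerivWithinAt
    have := (uniqueDiffOn_Icc hε 0 h0mem).eq_deriv _ hd1 hd2
    rwa [h0, hV0] at this
  rcases eq_or_ne v 0 with rfl | hv
  · have : G.spray x 0 = 0 := by simpa using G.spray_smul x 0 0
    simp [this]
  have hpos := G.form_pos hx hv
  obtain ⟨c, hc0, hc2⟩ : ∃ c : ℝ, c ≠ 0 ∧ c ^ 2 = G.form x v v :=
    ⟨_, (Real.sqrt_pos.2 hpos).ne', Real.sq_sqrt hpos.le⟩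
  obtain ⟨w, rfl⟩ : ∃ w, v = c • w := ⟨c⁻¹ • v, by rw [smul_smul, mul_inv_cancel₀ hc0, one_smul]⟩
  have hw : G.form x w w = 1 := by
    simp only [map_smul, _root_.smul_apply, smul_eq_mul] at hc2
    have : c ^ 2 * (G.form x w w - 1) = 0 := by linarith
    rcases mul_eq_zero.1 this with h | h
    · exact absurd h (pow_ne_zero 2 hc0)
    · linarith
  have := unit w hw
  rw [← hc2, G.spray_smul]
  simp only [map_smul, _root_.smul_apply, smul_eq_mul]
  linear_combination c ^ 2 * this

/-! ### The gradient of the entropy -/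

/-- The gradient `gⁱʲ ∂S/∂Iʲ` of the entropy. -/
noncomputable def gradient (x : Fin n → ℝ) : Fin n → ℝ :=
  fun i => ∑ j, (G.metric x)⁻¹ i j * partialDeriv j G.entropy x

lemma contDiffOn_gradient : ContDiffOn ℝ 1 G.gradient G.carrier := by
  rw [contDiffOn_pi]
  intro i
  exact ContDiffOn.sum fun j _ => ((G.contDiffOn_inv_metric i j).of_le (by norm_num)).mul
    (contDiffOn_partialDeriv G.isOpen_carrier G.contDiffOn_entropy j)

lemma gradient_differentiableAt {x : Fin n → ℝ} (hx : x ∈ G.carrier) :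
    DifferentiableAt ℝ G.gradient x :=
  (G.contDiffOn_gradient.contDiffAt (G.mem_nhds hx)).differentiableAt (by simp)

lemma form_gradient {x : Fin n → ℝ} (hx : x ∈ G.carrier) (w : Fin n → ℝ) :
    G.form x (G.gradient x) w = fderiv ℝ G.entropy x w := by
  have h : (G.metric x).mulVec (G.gradient x) = fun j => partialDeriv j G.entropy x := by
    have : G.gradient x = (G.metric x)⁻¹.mulVec (fun j => partialDeriv j G.entropy x) := by
      ext i
      simp [gradient, Matrix.mulVec, dotProduct]
    rw [this, Matrix.mulVec_mulVec,
      Matrix.mul_nonsing_inv _ (G.posDef_metric x hx).det_pos.ne'.isUnit, Matrix.one_mulVec]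
  rw [G.form_symm hx, RiemannianDomain.form_apply, fderiv_apply_eq_sum_partialDeriv]
  refine Finset.sum_congr rfl fun k _ => ?_
  rw [← congrFun h k]
  simp only [Matrix.mulVec, dotProduct, Finset.mul_sum]
  refine Finset.sum_congr rfl fun j _ => ?_
  ring

lemma forceSq_eq_fderiv_gradient (x : Fin n → ℝ) :
    G.forceSq x = fderiv ℝ G.entropy x (G.gradient x) := by
  rw [fderiv_apply_eq_sum_partialDeriv, forceSq]
  refine Finset.sum_congr rfl fun i _ => ?_
  simp only [gradient, force, Finset.sum_mul]
  refine Finset.sum_congr rfl fun j _ => ?_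
  ring

lemma forceSq_eq_form {x : Fin n → ℝ} (hx : x ∈ G.carrier) :
    G.forceSq x = G.form x (G.gradient x) (G.gradient x) := by
  rw [G.form_gradient hx, forceSq_eq_fderiv_gradient]

lemma forceSq_nonneg {x : Fin n → ℝ} (hx : x ∈ G.carrier) : 0 ≤ G.forceSq x := by
  rw [G.forceSq_eq_form hx]
  exact G.form_self_nonneg hx _

/-- The polarization of `hessian_entropy_self` in the direction of the gradient, with the Christoffel
symbols eliminated. -/
lemma hessian_entropy_gradient {x : Fin n → ℝ} (hx : x ∈ G.carrier) (w : Fin n → ℝ) :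
    2 * fderiv ℝ (fderiv ℝ G.entropy) x w (G.gradient x)
      = fderiv ℝ G.form x w (G.gradient x) (G.gradient x) - 2 * fderiv ℝ G.entropy x w := by
  have Q : ∀ v, fderiv ℝ (fderiv ℝ G.entropy) x v v
      - (fderiv ℝ G.form x v v (G.gradient x) - 1 / 2 * fderiv ℝ G.form x (G.gradient x) v v)
      = -G.form x v v := by
    intro v
    rw [← G.hessian_entropy_self hx v, ← G.form_gradient hx, G.form_symm hx, G.form_spray hx]
  set X := G.gradient x
  have hsymm : fderiv ℝ (fderiv ℝ G.entropy) x X w = fderiv ℝ (fderiv ℝ G.entropy) x w X :=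
    (G.entropy_contDiffAt hx).isSymmSndFDerivAt (by simp) X w
  have h1 := Q (X + w)
  have h2 := Q X
  have h3 := Q w
  simp only [map_add, _root_.add_apply] at h1
  have f1 := G.fderiv_form_symm hx X X w
  have f2 := G.form_symm hx w X
  have f3 := G.form_gradient hx w
  have f4 := G.fderiv_form_symm hx w w X
  change G.form x X w = _ at f3
  linarith

/-- The differential of `ψ²` is `-2 dS`. -/
lemma hasFDerivAt_forceSq {x : Fin n → ℝ} (hx : x ∈ G.carrier) :
    HasFDerivAt G.forceSq (-(2 : ℝ) • fderiv ℝ G.entropy x) x := by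
  have hX := (G.gradient_differentiableAt hx).hasFDerivAt
  have hS := (G.fderiv_entropy_differentiableAt hx).hasFDerivAt
  have hB := (G.form_differentiableAt hx).hasFDerivAt
  -- written as `2 dS(X) - g(X, X)`, the derivative of the gradient field `X` drops out of `d(ψ²)`
  have h1 := (hS.clm_apply hX).const_smul (2 : ℝ)
  have h2 := (hB.clm_apply hX).clm_apply hX
  have h3 := h1.sub h2
  have heq : G.forceSq =ᶠ[𝓝 x] fun y => 2 • fderiv ℝ G.entropy y (G.gradient y)
      - G.form y (G.gradient y) (G.gradient y) := by
    filter_upwards [G.mem_nhds hx] with y hy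
    rw [← G.forceSq_eq_form hy, ← G.forceSq_eq_fderiv_gradient, two_smul]
    ring
  refine (h3.congr_of_eventuallyEq (heq.trans ?_)).congr_fderiv ?_
  · exact Eventually.of_forall fun y => by simp
  ext w
  have hw := G.hessian_entropy_gradient hx w
  have hg := G.form_gradient hx (fderiv ℝ G.gradient x w)
  have hs := G.form_symm hx (fderiv ℝ G.gradient x w) (G.gradient x)
  simp
  linarith

/-! ### The gaussian form of the entropy -/

/-- `ψ² + 2 S` is constant on the manifold, and the normalization of the density identifies the
constant. -/
lemma entropy_eq {x : Fin n → ℝ} (hx : x ∈ G.carrier) :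
    G.entropy x = G.planckPotential - 1 / 2 * G.forceSq x := by
  have hd : ∀ y ∈ G.carrier, HasFDerivAt (fun z => G.entropy z + 1 / 2 * G.forceSq z)
      (0 : (Fin n → ℝ) →L[ℝ] ℝ) y := by
    intro y hy
    refine ((G.entropy_differentiableAt hy).hasFDerivAt.add
      ((G.hasFDerivAt_forceSq hy).const_mul (1 / 2))).congr_fderiv ?_
    rw [smul_smul]
    norm_num
  obtain ⟨c, hc⟩ := G.isOpen_carrier.exists_is_const_of_fderiv_eq_zero (𝕜 := ℝ)
    (f := fun z => G.entropy z + 1 / 2 * G.forceSq z) G.isConnected_carrier.isPreconnected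
    (fun y hy => (hd y hy).differentiableAt.differentiableWithinAt) fun y hy => (hd y hy).fderiv
  have hS : ∀ y ∈ G.carrier, G.entropy y = c + -(1 / 2) * G.forceSq y := fun y hy => by
    linarith [hc y hy]
  have h1 : Real.exp c * G.partitionFunction = 1 := by
    rw [← G.integral_density, partitionFunction, ← integral_const_mul]
    refine setIntegral_congr_fun G.isOpen_carrier.measurableSet fun y hy => ?_
    simp only [hS y hy, Real.exp_add]
    ring
  have hP : G.planckPotential = c := by
    rw [planckPotential, eq_div_of_mul_eq (Real.exp_pos c).ne' ((mul_comm _ _).trans h1),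
      one_div, Real.log_inv, Real.log_exp, neg_neg]
  rw [hP, hS x hx]
  ring

lemma forceSq_eq {x : Fin n → ℝ} (hx : x ∈ G.carrier) :
    G.forceSq x = 2 * (G.planckPotential - G.entropy x) := by
  linarith [G.entropy_eq hx]

lemma continuousOn_forceSq : ContinuousOn G.forceSq G.carrier := fun _ hx =>
  (G.hasFDerivAt_forceSq hx).continuousAt.continuousWithinAt

lemma gradient_eq_zero_iff {x : Fin n → ℝ} (hx : x ∈ G.carrier) :
    G.gradient x = 0 ↔ G.forceSq x = 0 := by
  rw [G.forceSq_eq_form hx, G.form_self_eq_zero hx]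

/-! ### Compactness of the superlevel sets of the entropy -/

/-- In admissible coordinates the volume density is bounded below, so that the entropy itself
tends to `-∞` on the boundary. -/
lemma exists_isCompact_entropy_lt (s : ℝ) :
    ∃ K, IsCompact K ∧ K ⊆ G.carrier ∧ ∀ x ∈ G.carrier \ K, G.entropy x < s := by
  obtain ⟨Θ, ⟨⟨-, -, hdet⟩, c, hc, hcle⟩, hvan⟩ := G.density_vanishesOnBoundary
  set a : ℝ := (2 * Real.pi)⁻¹ ^ n with ha
  have ha0 : 0 < a := by positivity
  obtain ⟨K, hK, hKM, hlt⟩ := hvan (Real.exp s * Real.sqrt (a * c)) (by positivity)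
  refine ⟨K, hK, hKM, fun x hx => ?_⟩
  have h := (le_abs_self _).trans_lt (hlt x hx)
  have hdx := hdet x hx.1
  have hdens : Real.sqrt (a * c) ≤ G.volumeDensity x / |(fderiv ℝ Θ x).det| := by
    rw [le_div_iff₀ (abs_pos.2 hdx), RiemannianDomain.volumeDensity, Matrix.det_smul,
      Fintype.card_fin, ← ha, abs_of_pos (mul_pos ha0 (G.posDef_metric x hx.1).det_pos),
      ← Real.sqrt_sq_eq_abs, ← Real.sqrt_mul (by positivity)]
    refine Real.sqrt_le_sqrt ?_
    have := (le_div_iff₀ (by positivity)).1 (hcle x hx.1)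
    nlinarith
  have hlt' : Real.exp (G.entropy x) * Real.sqrt (a * c) < Real.exp s * Real.sqrt (a * c) := by
    refine lt_of_le_of_lt ?_ h
    simp only [mul_div_assoc]
    gcongr
  exact Real.exp_lt_exp.1 (lt_of_mul_lt_mul_right hlt' (Real.sqrt_nonneg _))

lemma isCompact_forceSq_le (c : ℝ) : IsCompact {x | x ∈ G.carrier ∧ G.forceSq x ≤ c} := by
  obtain ⟨K, hK, hKM, hlt⟩ := G.exists_isCompact_entropy_lt (G.planckPotential - 1 / 2 * c)
  have : {x | x ∈ G.carrier ∧ G.forceSq x ≤ c} = K ∩ G.forceSq ⁻¹' Iic c := by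
    ext x
    refine ⟨fun h => ⟨by_contra fun hx => ?_, h.2⟩, fun h => ⟨hKM h.1, h.2⟩⟩
    have := hlt x ⟨h.1, hx⟩
    rw [G.entropy_eq h.1] at this
    linarith [h.2]
  rw [this]
  exact hK.of_isClosed_subset
    ((G.continuousOn_forceSq.mono hKM).preimage_isClosed_of_isClosed hK.isClosed isClosed_Iic)
    inter_subset_left

/-- Positions and velocities with bounded `ψ²` and bounded speed. -/
def phaseSublevel (c : ℝ) : Set ((Fin n → ℝ) × (Fin n → ℝ)) :=
  {z | z.1 ∈ G.carrier ∧ G.forceSq z.1 ≤ c ∧ G.form z.1 z.2 z.2 ≤ c}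

lemma continuousOn_form_self :
    ContinuousOn (fun z : (Fin n → ℝ) × (Fin n → ℝ) => G.form z.1 z.2 z.2)
      (G.carrier ×ˢ univ) := by
  have h : ContinuousOn (fun z : (Fin n → ℝ) × (Fin n → ℝ) => G.form z.1)
      (G.carrier ×ˢ univ) :=
    G.contDiffOn_form.continuousOn.comp continuousOn_fst fun z hz => hz.1
  exact (h.clm_apply continuousOn_snd).clm_apply continuousOn_snd

/-- Over a compact set of positions, vectors of bounded Riemannian norm have bounded coordinates. -/
lemma isCompact_phaseSublevel (c : ℝ) : IsCompact (G.phaseSublevel c) := by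
  set L := {x | x ∈ G.carrier ∧ G.forceSq x ≤ c} with hL
  have hLc : IsCompact L := G.isCompact_forceSq_le c
  -- the metric is uniformly positive definite on `L`
  obtain ⟨m, hm, hmle⟩ := (hLc.prod (isCompact_sphere (0 : Fin n → ℝ) 1)).exists_forall_le'
    (G.continuousOn_form_self.mono (prod_mono (fun x hx => hx.1) (subset_univ _))) (a := 0)
    fun z hz => G.form_pos hz.1.1 (fun h0 => by simpa [h0] using hz.2)
  have hbound : ∀ x ∈ L, ∀ v, m * ‖v‖ ^ 2 ≤ G.form x v v := by
    intro x hx v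
    rcases eq_or_ne v 0 with rfl | hv
    · simp
    have hv' : ‖v‖ ≠ 0 := norm_ne_zero_iff.2 hv
    have := hmle (x, ‖v‖⁻¹ • v) ⟨hx, by simp [norm_smul, hv']⟩
    simp only [map_smul, _root_.smul_apply, smul_eq_mul] at this
    calc m * ‖v‖ ^ 2 ≤ (‖v‖⁻¹ * (‖v‖⁻¹ * G.form x v v)) * ‖v‖ ^ 2 := by gcongr
      _ = G.form x v v := by field_simp
  set R := Real.sqrt (c / m)
  have hcomp := hLc.prod (isCompact_closedBall (0 : Fin n → ℝ) R)
  have : G.phaseSublevel c = (L ×ˢ Metric.closedBall (0 : Fin n → ℝ) R)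
      ∩ (fun z : (Fin n → ℝ) × (Fin n → ℝ) => G.form z.1 z.2 z.2) ⁻¹' Iic c := by
    ext z
    refine ⟨fun h => ⟨⟨⟨h.1, h.2.1⟩, ?_⟩, h.2.2⟩, fun h => ⟨h.1.1.1, h.1.1.2, h.2⟩⟩
    rw [mem_closedBall_zero_iff]
    refine Real.le_sqrt_of_sq_le ?_
    rw [le_div_iff₀ hm, mul_comm]
    exact (hbound z.1 ⟨h.1, h.2.1⟩ z.2).trans h.2.2
  rw [this]
  exact hcomp.of_isClosed_subset
    ((G.continuousOn_form_self.mono (prod_mono (fun x hx => hx.1) (subset_univ _))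
      ).preimage_isClosed_of_isClosed hcomp.isClosed isClosed_Iic) inter_subset_left

end ThermoStatGeometry

/-! ### Global solutions by cutting off the vector field -/

/-- A continuously differentiable vector field on an open set agrees near any compact subset with
a bounded and globally Lipschitz field. -/
lemma exists_lipschitzWith_bounded_eq_nhdsSet {E : Type*} [NormedAddCommGroup E]
    [NormedSpace ℝ E] [FiniteDimensional ℝ E] {F : E → E} {U K : Set E} (hU : IsOpen U)
    (hF : ContDiffOn ℝ 1 F U) (hK : IsCompact K) (hKU : K ⊆ U) :
    ∃ F' : E → E, (∃ C, LipschitzWith C F') ∧ (∃ B, ∀ z, ‖F' z‖ ≤ B) ∧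
      ∀ᶠ z in 𝓝ˢ K, F' z = F z := by
  obtain ⟨L, hL, hKL, hLU⟩ := exists_compact_between hK hU hKU
  obtain ⟨χ, h1, h0, -⟩ := exists_contMDiffMap_one_nhds_of_subset_interior (n := 1)
    (modelWithCornersSelf ℝ E) hK.isClosed hKL
  have hχ : ContDiff ℝ 1 χ := χ.contMDiff.contDiff
  have hsupp : HasCompactSupport fun z => χ z • F z :=
    HasCompactSupport.intro hL fun z hz => by rw [h0 z hz, zero_smul]
  have hsmooth : ContDiff ℝ 1 fun z => χ z • F z := by
    rw [contDiff_iff_contDiffAt]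
    intro z
    by_cases hz : z ∈ L
    · exact hχ.contDiffAt.smul (hF.contDiffAt (hU.mem_nhds (hLU hz)))
    · refine (contDiffAt_const (c := (0 : E))).congr_of_eventuallyEq ?_
      filter_upwards [hL.isClosed.isOpen_compl.mem_nhds hz] with w hw
      rw [h0 w hw, zero_smul]
  refine ⟨fun z => χ z • F z, hsmooth.lipschitzWith_of_hasCompactSupport hsupp (by simp),
    hsupp.exists_bound_of_continuous hsmooth.continuous, ?_⟩
  filter_upwards [h1] with z hz
  rw [hz, one_smul]

/-- A bounded, globally Lipschitz vector field has solutions on arbitrarily long time intervals. -/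
lemma LipschitzWith.exists_forall_hasDerivAt {E : Type*} [NormedAddCommGroup E]
    [NormedSpace ℝ E] [CompleteSpace E] {F : E → E} {C : NNReal} (hF : LipschitzWith C F) {B : ℝ}
    (hB : ∀ z, ‖F z‖ ≤ B) (z₀ : E) {T : ℝ} (hT : 0 < T) :
    ∃ y : ℝ → E, y 0 = z₀ ∧ ∀ t ∈ Ioo (-T) T, HasDerivAt y (F (y t)) t := by
  have hB0 : 0 ≤ B := (norm_nonneg _).trans (hB z₀)
  have hPL : IsPicardLindelof (fun _ => F) (tmin := -T) (tmax := T)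
      ⟨0, by constructor <;> linarith⟩ z₀ ⟨B * T, by positivity⟩ 0 ⟨B, hB0⟩ C :=
    { lipschitzOnWith := fun _ _ => hF.lipschitzOnWith
      continuousOn := fun _ _ => continuousOn_const
      norm_le := fun _ _ x _ => hB x
      mul_max_le := by
        change B * max (T - 0) (0 - -T) ≤ B * T - 0
        simp }
  obtain ⟨y, hy0, hy⟩ := hPL.exists_eq_forall_mem_Icc_hasDerivWithinAt₀
  exact ⟨y, hy0, fun t ht =>
    (hy t (Ioo_subset_Icc_self ht)).hasDerivAt (Icc_mem_nhds ht.1 ht.2)⟩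

namespace ThermoStatGeometry

variable {n : ℕ} (G : ThermoStatGeometry n)

/-! ### Geodesics in the direction of the gradient -/

variable {G} in
/-- Along the geodesic with initial velocity `grad S`, the entropy is the quadratic function of the
parameter whose maximum, at parameter `1`, is the Planck potential. -/
lemma forceSq_along_geodesic {x v : ℝ → Fin n → ℝ} {T : ℝ}
    (h : ∀ t ∈ Icc 0 T, G.IsGeodesicAt x v t) (hv : v 0 = G.gradient (x 0)) :
    ∀ t ∈ Icc 0 T, G.forceSq (x t) = G.forceSq (x 0) * (1 - t) ^ 2 := by
  intro t ht
  have h0 : (0 : ℝ) ∈ Icc 0 T := ⟨le_rfl, ht.1.trans ht.2⟩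
  have hspeed : ∀ t ∈ Icc 0 T, G.form (x t) (v t) (v t) = G.forceSq (x 0) := fun t ht => by
    rw [RiemannianDomain.form_velocity_eq h t ht, hv, G.forceSq_eq_form (h 0 h0).mem]
  have hd1 : ∀ t ∈ Icc 0 T, HasDerivAt
      (fun s => fderiv ℝ G.entropy (x s) (v s) + G.forceSq (x 0) * s) 0 t := by
    intro t ht
    refine ((G.hasDerivAt_fderiv_entropy_velocity (h t ht)).add
      ((hasDerivAt_id t).const_mul (G.forceSq (x 0)))).congr_deriv ?_
    rw [G.hessian_entropy_self (h t ht).mem, hspeed t ht]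
    ring
  have hlin : ∀ t ∈ Icc 0 T,
      fderiv ℝ G.entropy (x t) (v t) = G.forceSq (x 0) * (1 - t) := by
    intro t ht
    have := constant_of_has_deriv_right_zero
      (fun t ht => (hd1 t ht).continuousAt.continuousWithinAt)
      (fun t ht => (hd1 t (Ico_subset_Icc_self ht)).hasDerivWithinAt) t ht
    simp only [hv, mul_zero, add_zero, ← G.forceSq_eq_fderiv_gradient] at this
    linarith
  have hd2 : ∀ t ∈ Icc 0 T, HasDerivAt
      (fun s => G.forceSq (x s) - G.forceSq (x 0) * (1 - s) ^ 2) 0 t := by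
    intro t ht
    have hf : HasDerivAt (fun s => G.forceSq (x s))
        ((-(2 : ℝ) • fderiv ℝ G.entropy (x t)) (v t)) t :=
      (G.hasFDerivAt_forceSq (h t ht).mem).comp_hasDerivAt t (h t ht).hasDerivAt
    refine (hf.sub ((((hasDerivAt_id t).const_sub 1).pow 2).const_mul
      (G.forceSq (x 0)))).congr_deriv ?_
    rw [_root_.smul_apply, hlin t ht]
    simp
    ring
  have := constant_of_has_deriv_right_zero
    (fun t ht => (hd2 t ht).continuousAt.continuousWithinAt)
    (fun t ht => (hd2 t (Ico_subset_Icc_self ht)).hasDerivWithinAt) t ht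
  simp only [sub_zero, one_pow, mul_one, sub_self] at this
  linarith

variable {G} in
lemma mem_phaseSublevel_of_geodesic {x v : ℝ → Fin n → ℝ} {T c : ℝ} (hT : T ≤ 1)
    (h : ∀ t ∈ Icc 0 T, G.IsGeodesicAt x v t) (hv : v 0 = G.gradient (x 0))
    (hc : G.forceSq (x 0) ≤ c) : ∀ t ∈ Icc 0 T, (x t, v t) ∈ G.phaseSublevel c := by
  intro t ht
  have h0 : (0 : ℝ) ∈ Icc 0 T := ⟨le_rfl, ht.1.trans ht.2⟩
  refine ⟨(h t ht).mem, ?_, ?_⟩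
  · rw [forceSq_along_geodesic h hv t ht]
    have h1 : (1 - t) ^ 2 ≤ 1 := by
      have := ht.1
      have := ht.2
      nlinarith
    exact (mul_le_of_le_one_right (G.forceSq_nonneg (h 0 h0).mem) h1).trans hc
  · dsimp only
    rw [RiemannianDomain.form_velocity_eq h t ht, hv, ← G.forceSq_eq_form (h 0 h0).mem]
    exact hc

/-- The geodesic with initial velocity `grad S` exists up to the parameter `1`: the solution of the
cut-off equation is a geodesic as long as it stays in the compact set `phaseSublevel`, which it
cannot leave because speed and entropy are controlled along geodesics. -/
lemma exists_gradient_geodesic {x₀ : Fin n → ℝ} (hx₀ : x₀ ∈ G.carrier) :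
    ∃ x v : ℝ → Fin n → ℝ, x 0 = x₀ ∧ v 0 = G.gradient x₀ ∧
      ∀ t ∈ Icc (0 : ℝ) 1, G.IsGeodesicAt x v t := by
  set K := G.phaseSublevel (G.forceSq x₀) with hK
  have hKc : IsCompact K := G.isCompact_phaseSublevel _
  have hKU : K ⊆ G.carrier ×ˢ univ := fun z hz => ⟨hz.1, mem_univ _⟩
  obtain ⟨F, ⟨C, hC⟩, ⟨B, hB⟩, hF⟩ := exists_lipschitzWith_bounded_eq_nhdsSet
    G.isOpen_phaseSpace G.contDiffOn_geodesicField hKc hKU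
  obtain ⟨y, hy0, hy⟩ := hC.exists_forall_hasDerivAt hB (x₀, G.gradient x₀) (T := 2) (by norm_num)
  obtain ⟨W, hW, hKW, hWF⟩ := eventually_nhdsSet_iff_exists.1
    (hF.and (G.isOpen_phaseSpace.mem_nhdsSet.2 hKU))
  have hgeo : ∀ t ∈ Icc (0 : ℝ) 1, y t ∈ W →
      G.IsGeodesicAt (fun s => (y s).1) (fun s => (y s).2) t := by
    intro t ht hyt
    have htI : t ∈ Ioo (-2 : ℝ) 2 := ⟨by linarith [ht.1], by linarith [ht.2]⟩
    filter_upwards [(hy t htI).continuousAt.eventually_mem (hW.mem_nhds hyt),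
      Ioo_mem_nhds htI.1 htI.2] with s hs hsI
    have hd := hy s hsI
    rw [(hWF _ hs).1] at hd
    exact ⟨(hWF _ hs).2.1, hd.fst, hd.snd⟩
  have hcont : ContinuousOn y (Icc 0 1) := fun t ht =>
    (hy t ⟨by linarith [ht.1], by linarith [ht.2]⟩).continuousAt.continuousWithinAt
  have hstay : Icc (0 : ℝ) 1 ⊆ {t | y t ∈ K} := by
    refine IsClosed.Icc_subset_of_forall_mem_nhdsGT_of_Icc_subset ?_ ?_ ?_
    · rw [inter_comm]
      exact hcont.preimage_isClosed_of_isClosed isClosed_Icc hKc.isClosed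
    · rw [mem_ofPred_eq, hy0]
      exact ⟨hx₀, le_rfl, (G.forceSq_eq_form hx₀).ge⟩
    · intro t ht hsub
      have hyc : ContinuousAt y t :=
        (hy t ⟨by linarith [ht.1], by linarith [ht.2]⟩).continuousAt
      have hev : ∀ᶠ s in 𝓝 t, y s ∈ W ∧ s < 1 :=
        (hyc.eventually_mem (hW.mem_nhds (hKW (hsub ⟨ht.1, le_rfl⟩)))).and (eventually_lt_nhds ht.2)
      obtain ⟨δ, hδ, hball⟩ := Metric.eventually_nhds_iff_ball.1 hev
      filter_upwards [Ioo_mem_nhdsGT (lt_add_of_pos_right t hδ)] with τ hτ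
      have hnear : ∀ s ∈ Icc t τ, s ∈ Metric.ball t δ := fun s hs => by
        rw [Metric.mem_ball, Real.dist_eq, abs_of_nonneg (sub_nonneg.2 hs.1)]
        linarith [hs.2, hτ.2]
      have hτ1 : τ < 1 := (hball τ (hnear τ ⟨hτ.1.le, le_rfl⟩)).2
      refine mem_phaseSublevel_of_geodesic (x := fun s => (y s).1) (v := fun s => (y s).2) hτ1.le
        (fun s hs => hgeo s ⟨hs.1, hs.2.trans hτ1.le⟩ ?_) (by simp [hy0]) (by simp [hy0]) τ
        ⟨ht.1.trans hτ.1.le, le_rfl⟩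
      rcases le_total s t with hst | hst
      · exact hKW (hsub ⟨hs.1, hst⟩)
      · exact (hball s (hnear s ⟨hst, hs.2⟩)).1
  exact ⟨fun s => (y s).1, fun s => (y s).2, by simp [hy0], by simp [hy0],
    fun t ht => hgeo t ht (hKW (hstay ht))⟩

/-- The end point of the geodesic with initial velocity `grad S` depends continuously on the
starting point. -/
lemma exists_dist_endpoint_le (c : ℝ) : ∃ L : ℝ, ∀ x v x' v' : ℝ → Fin n → ℝ,
    (∀ t ∈ Icc (0 : ℝ) 1, G.IsGeodesicAt x v t) → v 0 = G.gradient (x 0) →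
    (∀ t ∈ Icc (0 : ℝ) 1, G.IsGeodesicAt x' v' t) → v' 0 = G.gradient (x' 0) →
    G.forceSq (x 0) ≤ c → G.forceSq (x' 0) ≤ c →
    dist (x 1) (x' 1) ≤ dist (x 0, v 0) (x' 0, v' 0) * L := by
  obtain ⟨F, ⟨C, hC⟩, -, hF⟩ := exists_lipschitzWith_bounded_eq_nhdsSet
    G.isOpen_phaseSpace G.contDiffOn_geodesicField (G.isCompact_phaseSublevel c)
    fun z hz => ⟨hz.1, mem_univ _⟩
  have hode : ∀ x v : ℝ → Fin n → ℝ, (∀ t ∈ Icc (0 : ℝ) 1, G.IsGeodesicAt x v t) →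
      v 0 = G.gradient (x 0) → G.forceSq (x 0) ≤ c → ∀ t ∈ Icc (0 : ℝ) 1,
      HasDerivAt (fun s => (x s, v s)) (F (x t, v t)) t := by
    intro x v h hv hc t ht
    rw [hF.self_of_nhdsSet _ (mem_phaseSublevel_of_geodesic le_rfl h hv hc t ht)]
    exact (h t ht).hasDerivAt.prodMk (h t ht).hasDerivAt_velocity
  refine ⟨Real.exp (C * (1 - 0)), fun x v x' v' h hv h' hv' hc hc' => ?_⟩
  have hd := hode x v h hv hc
  have hd' := hode x' v' h' hv' hc'
  have := dist_le_of_trajectories_ODE (v := fun _ => F) (fun _ => hC)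
    (fun t ht => (hd t ht).continuousAt.continuousWithinAt)
    (fun t ht => (hd t (Ico_subset_Icc_self ht)).hasDerivWithinAt)
    (fun t ht => (hd' t ht).continuousAt.continuousWithinAt)
    (fun t ht => (hd' t (Ico_subset_Icc_self ht)).hasDerivWithinAt) le_rfl 1
    (right_mem_Icc.2 zero_le_one)
  exact (le_max_left _ _).trans this

/-! ### Uniqueness of the stationary point -/

lemma fderiv_entropy_eq_zero {p : Fin n → ℝ} (hp : p ∈ G.carrier) (h0 : G.forceSq p = 0) :
    fderiv ℝ G.entropy p = 0 := by
  ext w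
  rw [← G.form_gradient hp, (G.gradient_eq_zero_iff hp).2 h0]
  simp

/-- Stationary points are isolated because the Hessian of the entropy is nondegenerate. -/
lemma isDiscrete_stationary : IsDiscrete {x | x ∈ G.carrier ∧ G.forceSq x = 0} := by
  refine IsDiscrete.of_nhdsWithin fun z hz => ?_
  have hinj : LinearMap.ker (fderiv ℝ (fderiv ℝ G.entropy) z).toLinearMap = ⊥ := by
    rw [LinearMap.ker_eq_bot']
    intro v hv
    have h := G.hessian_entropy_self hz.1 v
    have hv' : fderiv ℝ (fderiv ℝ G.entropy) z v = 0 := hv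
    rw [hv', G.fderiv_entropy_eq_zero hz.1 hz.2] at h
    exact (G.form_self_eq_zero hz.1).1 (by simpa using h.symm)
  obtain ⟨C, -, hC⟩ := LinearMap.exists_antilipschitzWith _ hinj
  have hne := (G.fderiv_entropy_differentiableAt hz.1).hasFDerivAt.eventually_ne (c := 0) ⟨C, hC⟩
  rw [eventually_nhdsWithin_iff] at hne
  rw [le_pure_iff, mem_nhdsWithin_iff_eventually]
  filter_upwards [hne] with x hx hxZ
  by_contra hxz
  exact hx hxz (G.fderiv_entropy_eq_zero hxZ.1 hxZ.2)

/-- The stationary point of the entropy: the map sending a point to the end of its gradient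
geodesic is continuous with values in the discrete set of stationary points, hence constant. -/
lemma exists_forall_gradient_geodesic_endpoint_eq :
    ∃ p ∈ G.carrier, G.forceSq p = 0 ∧ ∀ x₀ ∈ G.carrier,
      ∃ x v : ℝ → Fin n → ℝ, x 0 = x₀ ∧ v 0 = G.gradient x₀ ∧ x 1 = p ∧
        ∀ t ∈ Icc (0 : ℝ) 1, G.IsGeodesicAt x v t := by
  have h1mem : (1 : ℝ) ∈ Icc (0 : ℝ) 1 := right_mem_Icc.2 zero_le_one
  choose! x v hx hv hg using fun x₀ (h : x₀ ∈ G.carrier) => G.exists_gradient_geodesic h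
  have hend : ∀ q ∈ G.carrier, x q 1 ∈ {x | x ∈ G.carrier ∧ G.forceSq x = 0} := by
    intro q hq
    refine ⟨(hg q hq 1 h1mem).mem, ?_⟩
    rw [forceSq_along_geodesic (hg q hq) (by rw [hv q hq, hx q hq]) 1 h1mem]
    simp
  have hcont : ContinuousOn (fun q => x q 1) G.carrier := by
    intro q hq
    obtain ⟨L, hL⟩ := G.exists_dist_endpoint_le (G.forceSq q + 1)
    have hfc : ContinuousAt G.forceSq q := (G.hasFDerivAt_forceSq hq).continuousAt
    have hgc : ContinuousAt G.gradient q := (G.gradient_differentiableAt hq).continuousAt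
    have hlim : Tendsto (fun q' => dist (q', G.gradient q') (q, G.gradient q) * L) (𝓝 q) (𝓝 0) := by
      have : ContinuousAt (fun q' => dist (q', G.gradient q') (q, G.gradient q) * L) q :=
        ((continuousAt_id.prodMk hgc).dist continuousAt_const).mul continuousAt_const
      simpa [ContinuousAt] using this
    refine ContinuousAt.continuousWithinAt ?_
    refine tendsto_iff_dist_tendsto_zero.2
      (squeeze_zero' (Eventually.of_forall fun _ => dist_nonneg) ?_ hlim)
    filter_upwards [G.mem_nhds hq, hfc.eventually_lt_const (lt_add_one _)] with q' hq' hlt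
    have := hL (x q') (v q') (x q) (v q) (hg q' hq') (by rw [hv q' hq', hx q' hq']) (hg q hq)
      (by rw [hv q hq, hx q hq]) (by rw [hx q' hq']; exact hlt.le)
      (by rw [hx q hq]; linarith)
    rwa [hx q' hq', hv q' hq', hx q hq, hv q hq] at this
  obtain ⟨q, hq⟩ := G.isConnected_carrier.nonempty
  obtain ⟨p, hp, hconst⟩ := G.isConnected_carrier.isPreconnected.eqOn_const_of_mapsTo
    G.isDiscrete_stationary hcont hend ⟨_, hend q hq⟩
  exact ⟨p, hp.1, hp.2, fun x₀ h₀ => ⟨x x₀, v x₀, hx x₀ h₀, hv x₀ h₀, hconst h₀, hg x₀ h₀⟩⟩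

/-! ### The norm of the forces is the distance from the stationary point -/

lemma fderiv_entropy_sq_le {x : Fin n → ℝ} (hx : x ∈ G.carrier) (w : Fin n → ℝ) :
    fderiv ℝ G.entropy x w ^ 2 ≤ G.forceSq x * G.normSq x w := by
  rw [← G.form_gradient hx, G.forceSq_eq_form hx, G.normSq_eq_form]
  exact G.form_sq_le hx _ _

/-- Along a curve, `ψ` decreases at most by the length, because its gradient has norm at most `1`;
this is the case of a curve that ends where `ψ` vanishes. -/
lemma forceNorm_le_curveLength {γ : ℝ → Fin n → ℝ} {a b : ℝ} (hab : a ≤ b)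
    (hγ : ContDiffOn ℝ 1 γ (Icc a b)) (hM : ∀ t ∈ Icc a b, γ t ∈ G.carrier)
    (hb : G.forceSq (γ b) = 0) : G.forceNorm (γ a) ≤ G.curveLength γ a b := by
  rcases hab.eq_or_lt with rfl | hlt
  · simp [forceNorm, hb, RiemannianDomain.curveLength]
  have hder : ∀ t ∈ Ioo a b, HasDerivAt γ (deriv γ t) t := fun t ht =>
    ((hγ.differentiableOn (by simp) t (Ioo_subset_Icc_self ht)).differentiableAt
      (Icc_mem_nhds ht.1 ht.2)).hasDerivAt
  have hint : IntegrableOn (fun t => Real.sqrt (G.normSq (γ t) (deriv γ t))) (Icc a b) := by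
    have hc : ContinuousOn (fun t => Real.sqrt (G.normSq (γ t) (derivWithin γ (Icc a b) t)))
        (Icc a b) := by
      simp only [G.normSq_eq_form]
      have hf : ContinuousOn (fun t => G.form (γ t)) (Icc a b) :=
        G.contDiffOn_form.continuousOn.comp hγ.continuousOn hM
      have hd := hγ.continuousOn_derivWithin (uniqueDiffOn_Icc hlt) le_rfl
      exact Real.continuous_sqrt.comp_continuousOn ((hf.clm_apply hd).clm_apply hd)
    have hi := hc.integrableOn_Icc (μ := volume)
    rw [integrableOn_Icc_iff_integrableOn_Ioo] at hi ⊢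
    refine hi.congr_fun (fun t ht => ?_) measurableSet_Ioo
    simp only [derivWithin_of_mem_nhds (Icc_mem_nhds ht.1 ht.2)]
  refine le_of_forall_pos_le_add fun ε hε => ?_
  -- `ψ` itself need not be differentiable where it vanishes, so `√(ψ² + ε²)` replaces it
  have hpos : ∀ t ∈ Icc a b, 0 < G.forceSq (γ t) + ε ^ 2 := fun t ht =>
    add_pos_of_nonneg_of_pos (G.forceSq_nonneg (hM t ht)) (by positivity)
  have hmain := intervalIntegral.sub_le_integral_of_hasDeriv_right_of_le hab
    (g := fun t => -Real.sqrt (G.forceSq (γ t) + ε ^ 2))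
    (g' := fun t => fderiv ℝ G.entropy (γ t) (deriv γ t) / Real.sqrt (G.forceSq (γ t) + ε ^ 2))
    ?_ ?_ hint ?_
  · rw [RiemannianDomain.curveLength]
    have h1 : G.forceNorm (γ a) ≤ Real.sqrt (G.forceSq (γ a) + ε ^ 2) :=
      Real.sqrt_le_sqrt (by linarith [sq_nonneg ε])
    simp only [hb, zero_add, Real.sqrt_sq hε.le] at hmain
    linarith
  · exact (Real.continuous_sqrt.comp_continuousOn
      ((G.continuousOn_forceSq.comp hγ.continuousOn hM).add continuousOn_const)).neg
  · intro t ht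
    have htI := Ioo_subset_Icc_self ht
    have h1 : HasDerivAt (fun s => G.forceSq (γ s))
        ((-(2 : ℝ) • fderiv ℝ G.entropy (γ t)) (deriv γ t)) t :=
      (G.hasFDerivAt_forceSq (hM t htI)).comp_hasDerivAt t (hder t ht)
    have h2 := ((h1.add_const (ε ^ 2)).sqrt (hpos t htI).ne').neg
    refine (h2.congr_deriv ?_).hasDerivWithinAt
    rw [_root_.smul_apply, smul_eq_mul]
    ring
  · intro t ht
    have htI := Ioo_subset_Icc_self ht
    rw [div_le_iff₀ (Real.sqrt_pos.2 (hpos t htI)), mul_comm,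
      ← Real.sqrt_mul (hpos t htI).le]
    refine Real.le_sqrt_of_sq_le ((G.fderiv_entropy_sq_le (hM t htI) _).trans ?_)
    have : 0 ≤ G.normSq (γ t) (deriv γ t) := by
      rw [G.normSq_eq_form]
      exact G.form_self_nonneg (hM t htI) _
    nlinarith [sq_nonneg ε]

variable {G} in
lemma contDiffOn_of_isGeodesicAt {x v : ℝ → Fin n → ℝ}
    (h : ∀ t ∈ Icc (0 : ℝ) 1, G.IsGeodesicAt x v t) : ContDiffOn ℝ 1 x (Icc 0 1) := by
  have hu := uniqueDiffOn_Icc (zero_lt_one (α := ℝ))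
  refine (contDiffOn_one_iff_derivWithin hu).2 ⟨fun t ht =>
    (h t ht).hasDerivAt.differentiableAt.differentiableWithinAt, ?_⟩
  have hv : ContinuousOn v (Icc 0 1) := fun t ht =>
    (h t ht).hasDerivAt_velocity.continuousAt.continuousWithinAt
  exact hv.congr fun t ht => (h t ht).hasDerivAt.hasDerivWithinAt.derivWithin (hu t ht)

variable {G} in
lemma form_velocity_gradient_geodesic {x v : ℝ → Fin n → ℝ}
    (h : ∀ t ∈ Icc (0 : ℝ) 1, G.IsGeodesicAt x v t) (hv : v 0 = G.gradient (x 0)) :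
    ∀ t ∈ Icc (0 : ℝ) 1, G.form (x t) (v t) (v t) = G.forceSq (x 0) := fun t ht => by
  rw [RiemannianDomain.form_velocity_eq h t ht, hv,
    G.forceSq_eq_form (h 0 (left_mem_Icc.2 zero_le_one)).mem]

variable {G} in
lemma curveLength_gradient_geodesic {x v : ℝ → Fin n → ℝ}
    (h : ∀ t ∈ Icc (0 : ℝ) 1, G.IsGeodesicAt x v t) (hv : v 0 = G.gradient (x 0)) :
    G.curveLength x 0 1 = G.forceNorm (x 0) := by
  have : EqOn (fun t => Real.sqrt (G.normSq (x t) (deriv x t))) (fun _ => G.forceNorm (x 0))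
      (uIcc 0 1) := by
    intro t ht
    rw [uIcc_of_le zero_le_one] at ht
    simp only [G.normSq_eq_form, (h t ht).hasDerivAt.deriv,
      form_velocity_gradient_geodesic h hv t ht, forceNorm]
  rw [RiemannianDomain.curveLength, intervalIntegral.integral_congr this]
  simp

/-- If the gradient geodesic from `x 0` ends in a stationary point, then it realizes the distance
to that point, which is `ψ`. -/
lemma forceNorm_eq_distance {x v : ℝ → Fin n → ℝ}
    (h : ∀ t ∈ Icc (0 : ℝ) 1, G.IsGeodesicAt x v t) (hv : v 0 = G.gradient (x 0)) :
    G.forceNorm (x 0) = G.distance (x 0) (x 1) := by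
  have h1mem : (1 : ℝ) ∈ Icc (0 : ℝ) 1 := right_mem_Icc.2 zero_le_one
  have hmem : G.forceNorm (x 0) ∈ {L : ℝ | ∃ (γ : ℝ → Fin n → ℝ) (a b : ℝ), a ≤ b ∧
      ContDiffOn ℝ 1 γ (Icc a b) ∧ (∀ t ∈ Icc a b, γ t ∈ G.carrier) ∧ γ a = x 0 ∧ γ b = x 1 ∧
      L = G.curveLength γ a b} :=
    ⟨x, 0, 1, zero_le_one, contDiffOn_of_isGeodesicAt h, fun t ht => (h t ht).mem, rfl, rfl,
      (curveLength_gradient_geodesic h hv).symm⟩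
  have hlow : ∀ L ∈ {L : ℝ | ∃ (γ : ℝ → Fin n → ℝ) (a b : ℝ), a ≤ b ∧
      ContDiffOn ℝ 1 γ (Icc a b) ∧ (∀ t ∈ Icc a b, γ t ∈ G.carrier) ∧ γ a = x 0 ∧ γ b = x 1 ∧
      L = G.curveLength γ a b}, G.forceNorm (x 0) ≤ L := by
    rintro L ⟨γ, a, b, hab, hγ, hM, ha, hb, rfl⟩
    rw [← ha]
    refine G.forceNorm_le_curveLength hab hγ hM ?_
    rw [hb, forceSq_along_geodesic h hv 1 h1mem]
    simp
  exact le_antisymm (le_csInf ⟨_, hmem⟩ hlow) (csInf_le ⟨_, hlow⟩ hmem)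

end ThermoStatGeometry

namespace RiemannianDomain

variable {n : ℕ} (M : RiemannianDomain n)

/-! ### Geodesic spheres -/

variable {M} in
lemma IsGeodesicAt.comp_affine {x v : ℝ → Fin n → ℝ} {c d t : ℝ}
    (h : M.IsGeodesicAt x v (c * t + d)) :
    M.IsGeodesicAt (fun s => x (c * s + d)) (fun s => c • v (c * s + d)) t := by
  have hcont : ContinuousAt (fun s : ℝ => c * s + d) t := by fun_prop
  have ha : ∀ s : ℝ, HasDerivAt (fun s : ℝ => c * s + d) c s := fun s => by
    simpa using ((hasDerivAt_id s).const_mul c).add_const d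
  filter_upwards [hcont.eventually h] with s hs
  refine ⟨hs.1, hs.2.1.scomp s (ha s), ?_⟩
  refine ((hs.2.2.scomp s (ha s)).const_smul c).congr_deriv ?_
  rw [M.spray_smul, smul_smul, smul_neg, sq]

/-- Parameter intervals of length zero only see the second order germ of a curve, and some germ of
a unit geodesic starts at each point. -/
lemma exists_isUnitGeodesicOn_Icc_zero (hn : 0 < n) {p : Fin n → ℝ} (hp : p ∈ M.carrier) :
    ∃ γ : ℝ → Fin n → ℝ, M.IsUnitGeodesicOn γ (Icc 0 0) ∧ γ 0 = p := by
  have : Nonempty (Fin n) := ⟨⟨0, hn⟩⟩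
  obtain ⟨w, hw⟩ := exists_ne (0 : Fin n → ℝ)
  have hpos := M.form_pos hp hw
  obtain ⟨γ, V, ε, hε, h0, hV0, hg⟩ :=
    M.exists_isGeodesicAt hp ((Real.sqrt (M.form p w w))⁻¹ • w)
  refine ⟨γ, isUnitGeodesicOn_of_isGeodesicAt (v := V) (fun t ht => ?_) (fun t ht => ?_), h0⟩
  · exact hg t ⟨ht.1, ht.2.trans hε.le⟩
  · obtain rfl : t = 0 := le_antisymm ht.2 ht.1
    have hs : Real.sqrt (M.form p w w) * Real.sqrt (M.form p w w) = M.form p w w :=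
      Real.mul_self_sqrt hpos.le
    have hs0 : Real.sqrt (M.form p w w) ≠ 0 := (Real.sqrt_pos.2 hpos).ne'
    rw [h0, hV0]
    simp only [map_smul, _root_.smul_apply, smul_eq_mul]
    nth_rewrite 3 [← hs]
    field_simp

end RiemannianDomain

namespace ThermoStatGeometry

variable {n : ℕ} (G : ThermoStatGeometry n)

/-- A unit geodesic from a stationary point reaches `ψ = r` at the parameter `r`. -/
lemma forceSq_of_isUnitGeodesicOn {γ : ℝ → Fin n → ℝ} {r : ℝ} (hr : 0 ≤ r)
    (h : G.IsUnitGeodesicOn γ (Icc 0 r)) (h0 : G.forceSq (γ 0) = 0) :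
    G.forceSq (γ r) = r ^ 2 := by
  have hdiff : ∀ t ∈ Icc 0 r, DifferentiableAt ℝ (fun s => G.entropy (γ s)) t := fun t ht =>
    (G.hasDerivAt_entropy_comp (h t ht).1 (h t ht).2.1.hasDerivAt).differentiableAt
  have h0mem : (0 : ℝ) ∈ Icc 0 r := ⟨le_rfl, hr⟩
  have hstart : deriv (fun s => G.entropy (γ s)) 0 = 0 := by
    rw [(G.hasDerivAt_entropy_comp (h 0 h0mem).1 (h 0 h0mem).2.1.hasDerivAt).deriv,
      G.fderiv_entropy_eq_zero (h 0 h0mem).1 h0]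
    simp
  have hd : ∀ t ∈ Icc 0 r, HasDerivAt (fun s => G.entropy (γ s) + 1 / 2 * s ^ 2) 0 t := by
    intro t ht
    refine ((hdiff t ht).hasDerivAt.add (((hasDerivAt_id t).pow 2).const_mul _)).congr_deriv ?_
    rw [G.deriv_entropy_of_isUnitGeodesicOn h ht, hstart]
    simp
  have hrmem : r ∈ Icc 0 r := ⟨hr, le_rfl⟩
  have := constant_of_has_deriv_right_zero
    (fun t ht => (hd t ht).continuousAt.continuousWithinAt)
    (fun t ht => (hd t (Ico_subset_Icc_self ht)).hasDerivWithinAt) r hrmem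
  rw [G.forceSq_eq (h 0 h0mem).1] at h0
  rw [G.forceSq_eq (h r hrmem).1]
  linarith

/-- The reversed gradient geodesic is a unit geodesic from the stationary point. -/
lemma mem_geodesicSphere {x v : ℝ → Fin n → ℝ}
    (h : ∀ t ∈ Icc (0 : ℝ) 1, G.IsGeodesicAt x v t) (hv : v 0 = G.gradient (x 0))
    (hpos : 0 < G.forceSq (x 0)) : x 0 ∈ G.geodesicSphere (x 1) (G.forceNorm (x 0)) := by
  set r := G.forceNorm (x 0) with hr
  have hr0 : 0 < r := Real.sqrt_pos.2 hpos
  have hr2 : r ^ 2 = G.forceSq (x 0) := Real.sq_sqrt hpos.le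
  have hpar : ∀ t ∈ Icc 0 r, -r⁻¹ * t + 1 ∈ Icc (0 : ℝ) 1 := by
    intro t ht
    have h1 : 0 ≤ r⁻¹ * t := mul_nonneg (by positivity) ht.1
    have h2 : r⁻¹ * t ≤ 1 := by
      rw [inv_mul_le_iff₀ hr0]
      simpa using ht.2
    constructor <;> linarith
  refine ⟨fun s => x (-r⁻¹ * s + 1),
    RiemannianDomain.isUnitGeodesicOn_of_isGeodesicAt (v := fun s => -r⁻¹ • v (-r⁻¹ * s + 1))
      (fun t ht => (h _ (hpar t ht)).comp_affine) (fun t ht => ?_), by simp, ?_⟩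
  · simp only [map_smul, _root_.smul_apply, smul_eq_mul]
    rw [form_velocity_gradient_geodesic h hv _ (hpar t ht), ← hr2]
    field_simp
  · have : -r⁻¹ * r + 1 = 0 := by field_simp; ring
    simp only [this]

/-- A gradient geodesic starting in a stationary point is constant. -/
lemma endpoint_eq_of_forceSq_eq_zero {x v : ℝ → Fin n → ℝ}
    (h : ∀ t ∈ Icc (0 : ℝ) 1, G.IsGeodesicAt x v t) (hv : v 0 = G.gradient (x 0))
    (h0 : G.forceSq (x 0) = 0) : x 1 = x 0 := by
  refine constant_of_has_deriv_right_zero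
    (fun t ht => (h t ht).hasDerivAt.continuousAt.continuousWithinAt)
    (fun t ht => ?_) 1 (right_mem_Icc.2 zero_le_one)
  have ht' := Ico_subset_Icc_self ht
  have hvt : v t = 0 := (G.form_self_eq_zero (h t ht').mem).1
    ((form_velocity_gradient_geodesic h hv t ht').trans h0)
  simpa [hvt] using (h t ht').hasDerivAt.hasDerivWithinAt (s := Ici t)

/-- In dimension at least one, the boundary of a sublevel set of `ψ²` is the level set: `ψ²` has no
local maximum away from its only zero, and that zero is not an isolated point of `ℝⁿ`. -/
lemma frontier_forceSq_le (hn : 0 < n) {p : Fin n → ℝ}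
    (huniq : ∀ x ∈ G.carrier, G.forceSq x = 0 → x = p) (k : ℝ) :
    frontier {x | x ∈ G.carrier ∧ G.forceSq x ≤ k} = {x | x ∈ G.carrier ∧ G.forceSq x = k} := by
  have : Nonempty (Fin n) := ⟨⟨0, hn⟩⟩
  rw [(G.isCompact_forceSq_le k).isClosed.frontier_eq]
  ext x
  constructor
  · rintro ⟨⟨hx, hle⟩, hint⟩
    refine ⟨hx, hle.antisymm (le_of_not_gt fun hlt => hint ?_)⟩
    rw [mem_interior_iff_mem_nhds]
    filter_upwards [G.mem_nhds hx,
      (G.hasFDerivAt_forceSq hx).continuousAt.eventually_lt_const hlt] with y hy hylt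
    exact ⟨hy, hylt.le⟩
  · rintro ⟨hx, rfl⟩
    refine ⟨⟨hx, le_rfl⟩, fun hint => ?_⟩
    rw [mem_interior_iff_mem_nhds] at hint
    -- an interior point of the ball on the level set is a local maximum of `ψ²`, hence stationary
    have hmax : IsLocalMax G.forceSq x := by
      filter_upwards [hint] with y hy
      exact hy.2
    have hd := hmax.hasFDerivAt_eq_zero (G.hasFDerivAt_forceSq hx)
    have h0 : G.forceSq x = 0 := by
      have h2 := congrArg (fun f : (Fin n → ℝ) →L[ℝ] ℝ => f (G.gradient x)) hd
      simp only [_root_.smul_apply, ← G.forceSq_eq_fderiv_gradient, smul_eq_mul] at h2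
      simpa using h2
    rw [h0] at hint
    have hsub : {y | y ∈ G.carrier ∧ G.forceSq y ≤ 0} ⊆ {p} := fun y hy =>
      huniq y hy.1 (hy.2.antisymm (G.forceSq_nonneg hy.1))
    have hxp : x = p := huniq x hx h0
    have hnhds := mem_of_superset hint hsub
    rw [hxp] at hnhds
    have := mem_interior_iff_mem_nhds.2 hnhds
    rw [interior_singleton] at this
    exact this

end ThermoStatGeometry

theorem mainTheorem7 {n : ℕ} (hn : 0 < n) (G : ThermoStatGeometry n) :
    ∃ Ibar ∈ G.carrier,
      (∀ I ∈ G.carrier, I ≠ Ibar → G.entropy I < G.entropy Ibar) ∧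
      (∀ I ∈ G.carrier, G.forceSq I = 0 ↔ I = Ibar) ∧
      (∀ I ∈ G.carrier, G.forceNorm I = G.distance I Ibar) ∧
      (∀ I ∈ G.carrier, G.entropy I = G.planckPotential - 1 / 2 * G.forceSq I) ∧
      (∀ I ∈ G.carrier, G.entropy I = G.planckPotential - 1 / 2 * G.distance I Ibar ^ 2) ∧
      (∀ I₀ ∈ G.carrier,
        {I | I ∈ G.carrier ∧ G.entropy I = G.entropy I₀}
            = frontier (G.solidSphere Ibar (G.distance I₀ Ibar)) ∧
        {I | I ∈ G.carrier ∧ G.entropy I = G.entropy I₀}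
            = G.metricSphere Ibar (G.distance I₀ Ibar) ∧
        {I | I ∈ G.carrier ∧ G.entropy I = G.entropy I₀}
            = G.geodesicSphere Ibar (G.distance I₀ Ibar)) := by
  obtain ⟨p, hp, hp0, hgeo⟩ := G.exists_forall_gradient_geodesic_endpoint_eq
  have huniq : ∀ x ∈ G.carrier, G.forceSq x = 0 → x = p := by
    intro x₀ hx₀ h0
    obtain ⟨x, v, rfl, hv, rfl, hg⟩ := hgeo x₀ hx₀
    exact (G.endpoint_eq_of_forceSq_eq_zero hg hv h0).symm
  have hdist : ∀ x ∈ G.carrier, G.forceNorm x = G.distance x p := by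
    intro x₀ hx₀
    obtain ⟨x, v, rfl, hv, rfl, hg⟩ := hgeo x₀ hx₀
    exact G.forceNorm_eq_distance hg hv
  have hdist0 : ∀ x ∈ G.carrier, 0 ≤ G.distance x p := fun x hx =>
    (hdist x hx) ▸ Real.sqrt_nonneg _
  have hdistSq : ∀ x ∈ G.carrier, G.distance x p ^ 2 = G.forceSq x := fun x hx => by
    rw [← hdist x hx, ThermoStatGeometry.forceNorm, Real.sq_sqrt (G.forceSq_nonneg hx)]
  refine ⟨p, hp, fun x hx hne => ?_, fun x hx => ⟨huniq x hx, fun h => h ▸ hp0⟩, hdist,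
    fun x hx => G.entropy_eq hx, fun x hx => by rw [hdistSq x hx, G.entropy_eq hx], ?_⟩
  · have hpos := (G.forceSq_nonneg hx).lt_of_ne' fun h => hne (huniq x hx h)
    rw [G.entropy_eq hx, G.entropy_eq hp, hp0]
    linarith
  intro x₀ hx₀
  have hlevel : {x | x ∈ G.carrier ∧ G.entropy x = G.entropy x₀}
      = {x | x ∈ G.carrier ∧ G.forceSq x = G.forceSq x₀} := by
    ext x
    refine and_congr_right fun hx => ?_
    rw [G.forceSq_eq hx, G.forceSq_eq hx₀]
    constructor <;> intro h <;> linarith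
  rw [hlevel]
  refine ⟨?_, ?_, ?_⟩
  · have : G.solidSphere p (G.distance x₀ p)
        = {x | x ∈ G.carrier ∧ G.forceSq x ≤ G.forceSq x₀} := by
      ext x
      refine and_congr_right fun hx => ?_
      rw [← hdistSq x hx, ← hdistSq x₀ hx₀]
      exact (sq_le_sq₀ (hdist0 x hx) (hdist0 x₀ hx₀)).symm
    rw [this, G.frontier_forceSq_le hn huniq]
  · ext x
    refine and_congr_right fun hx => ?_
    rw [← hdistSq x hx, ← hdistSq x₀ hx₀]
    exact sq_eq_sq₀ (hdist0 x hx) (hdist0 x₀ hx₀)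
  · ext x
    constructor
    · rintro ⟨hx, heq⟩
      have hr : G.distance x₀ p = G.forceNorm x := by
        rw [← hdist x₀ hx₀, ThermoStatGeometry.forceNorm, ThermoStatGeometry.forceNorm, heq]
      rw [hr]
      rcases (G.forceSq_nonneg hx).eq_or_lt with h0 | hpos
      · obtain ⟨γ, hγ, hγ0⟩ := G.exists_isUnitGeodesicOn_Icc_zero hn hp
        rw [ThermoStatGeometry.forceNorm, ← h0, Real.sqrt_zero]
        exact ⟨γ, hγ, hγ0, hγ0.trans (huniq x hx h0.symm).symm⟩
      · obtain ⟨y, v, rfl, hv, rfl, hg⟩ := hgeo x hx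
        exact G.mem_geodesicSphere hg hv hpos
    · rintro ⟨γ, hγ, hγ0, rfl⟩
      have hr := hdist0 x₀ hx₀
      refine ⟨(hγ _ ⟨hr, le_rfl⟩).1, ?_⟩
      rw [G.forceSq_of_isUnitGeodesicOn hr hγ (by rw [hγ0, hp0]), hdistSq x₀ hx₀]
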